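/- **Theorem.** Let $X$ be a compact Hausdorff space, let $\mathcal A=C(X)$ be a commutative unital $C^*$-algebra with spectrum $X$ (we write $a(x)$ for the value of the character $x\in X$ at $a\in\mathcal A$), and let $\delta:\mathcal A\to\mathcal A$ be a $*$-endomorphism (not necessarily unital). Let $(X,\alpha)$ be the partial dynamical system generated by $(\mathcal A,\delta)$: $\alpha:\Delta_1\to X$ is continuous, $\Delta_1\subset X$ is clopen, and $\delta(a)(x)=a(\alpha(x))$ for $x\in\Delta_1$, $\delta(a)(x)=0$ for $x\notin\Delta_1$. Let $\Delta_n$ be the domain of $\alpha^n$ and let $\Delta_{-1}=\alpha(\Delta_1)$. *The natural extension of $(\mathcal A,\delta)$.* Put $I=\ker\delta$, let $I^\perp$ be the largest ideal of $\mathcal A$ with $I\cap I^\perp=\{0\}$, and let $\mathcal A^+=\mathcal A/I\oplus\mathcal A/I^\perp$, which contains $\mathcal A$ via $a\mapsto(a+I)\oplus(a+I^\perp)$ and carries the endomorphism $\delta\big((a+I)\oplus(b+I^\perp)\big)=(\delta(a)+I)\oplus(\delta(a)+I^\perp)$. The kernel of this endomorphism has the unit $q=0\oplus(1+I^\perp)$.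 With $\mathcal A_n=\delta^n(1)\mathcal A^+\delta^n(1)$ put $\mathcal B_n=q\mathcal A_0\oplus\dots\oplus q\mathcal A_{n-1}\oplus\mathcal A_n$, and let $\mathcal B$ be the $C^*$-algebraic direct limit of $\mathcal B_0\to\mathcal B_1\to\cdots$ under the maps $a_0\oplus\dots\oplus a_n\mapsto a_0\oplus\dots\oplus a_{n-1}\oplus qa_n\oplus\delta(a_n)$. The left shifts $\mathcal B_{n+1}\to\mathcal B_n$, $a_0\oplus\dots\oplus a_{n+1}\mapsto a_1\oplus\dots\oplus a_{n+1}$, induce an endomorphism $\delta:\mathcal B\to\mathcal B$ that extends $\delta:\mathcal A\to\mathcal A$. The system $(\mathcal B,\delta)$ is the natural extension of $(\mathcal A,\delta)$. *The natural extension of $(X,\alpha)$.* Let $0$ be an abstract point, adjoined to $X$ so that $\{0\}$ is clopen in $X\cup\{0\}$, and let $$\widetilde X=\bigcup_{N=0}^\infty X_N\cup X_\infty\subset\prod_{n=0}^\infty (X\cup\{0\})$$ with the topology inherited from the product topology, where $$X_N=\{(x_0,\dots,x_N,0,0,\dots): x_n\in\Delta_n \text{ for } 0\le n\le N,\ \alpha(x_n)=x_{n-1}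 \text{ for } 1\le n\le N,\ x_N\in\overline{X\setminus\Delta_{-1}}\},$$ $$X_\infty=\{(x_0,x_1,\dots): x_n\in\Delta_n \text{ for } n\ge 0,\ \alpha(x_n)=x_{n-1} \text{ for } n\ge1\}.$$ Let $\widetilde\Delta_1=\{(x_0,x_1,\dots)\in\widetilde X: x_0\in\Delta_1\}$, which is clopen, and let $\widetilde\alpha(x_0,x_1,\dots)=(\alpha(x_0),x_0,x_1,\dots)$ for $(x_0,x_1,\dots)\in\widetilde\Delta_1$. Then: 1. $\widetilde\alpha$ is a homeomorphism of $\widetilde\Delta_1$ onto the open set $\widetilde\Delta_{-1}=\{(x_0,x_1,\dots)\in\widetilde X: x_1\in\Delta_1\}$. 2. $(\mathcal B,\delta)$ has a complete transfer operator $\delta_*$; that is, the kernel of $\delta$ in $\mathcal B$ has a unit $q$ and there is a map $\delta_*:\mathcal B\to(1-q)\mathcal B$ with $\delta(\delta_*(b))=\delta(1)b\,\delta(1)$ for all $b\in\mathcal B$. 3. $(\widetilde X,\widetilde\alpha)$ is the partial dynamical system generated by $(\mathcal B,\delta)$: there is a homeomorphism of $\widetilde X$ onto the spectrum of $\mathcal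 B$ (the space of non-zero multiplicative linear functionals, with the weak$^*$ topology) under which $\delta(b)(\widetilde x)=b(\widetilde\alpha(\widetilde x))$ for $\widetilde x\in\widetilde\Delta_1$ and $\delta(b)(\widetilde x)=0$ for $\widetilde x\notin\widetilde\Delta_1$, for all $b\in\mathcal B$. The character corresponding to $\widetilde x=(x_0,x_1,\dots)$ satisfies $\widetilde x(\delta_*^n(a))=a(x_n)$ for all $a\in\mathcal A$ and $n\ge0$, with the convention $a(0)=0$. -/

import Mathlib

universe u v

noncomputable section

open Filter Topology

namespace NatExt

/-- A closed ideal of a commutative C*-algebra. (Closed ideals are automatically stable under the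
involution; the field `star_mem` only records this.) -/
structure CStarIdeal (A : Type u) [CommCStarAlgebra A] where
  ideal : Ideal A
  isClosed : IsClosed (ideal : Set A)
  star_mem : ∀ a ∈ ideal, star a ∈ ideal

namespace CStarIdeal
variable {A : Type u} [CommCStarAlgebra A] (I : CStarIdeal A)

/-- The quotient `A / I` with the quotient norm. -/
def Quotient : Type u := A ⧸ I.ideal

instance : IsClosed (I.ideal : Set A) := I.isClosed
instance : NormedCommRing I.Quotient :=
  inferInstanceAs (NormedCommRing (A ⧸ I.ideal))
instance : NormedAlgebra ℂ I.Quotient :=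
  inferInstanceAs (NormedAlgebra ℂ (A ⧸ I.ideal))
instance : CompleteSpace I.Quotient :=
  inferInstanceAs (CompleteSpace (A ⧸ I.ideal))

/-- The quotient map as an algebra homomorphism. -/
def mkHom : A →ₐ[ℂ] I.Quotient := Ideal.Quotient.mkₐ ℂ I.ideal

theorem mkHom_surjective : Function.Surjective I.mkHom := Ideal.Quotient.mk_surjective

theorem mkHom_eq_iff (a b : A) : I.mkHom a = I.mkHom b ↔ a - b ∈ I.ideal :=
  Ideal.Quotient.mk_eq_mk_iff_sub_mem a b

instance : StarRing I.Quotient where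
  star := Quotient.lift (fun a => I.mkHom (star a)) (by
    intro a b hab
    have h : a - b ∈ I.ideal := (Submodule.quotientRel_def _).1 hab
    rw [mkHom_eq_iff, ← star_sub]
    exact I.star_mem _ h)
  star_involutive := by
    intro x
    obtain ⟨a, rfl⟩ := I.mkHom_surjective x
    exact congrArg I.mkHom (star_star a)
  star_mul := by
    intro x y
    obtain ⟨a, rfl⟩ := I.mkHom_surjective x
    obtain ⟨b, rfl⟩ := I.mkHom_surjective y
    exact (congrArg I.mkHom (star_mul a b)).trans (map_mul I.mkHom _ _)
  star_add := by
    intro x y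
    obtain ⟨a, rfl⟩ := I.mkHom_surjective x
    obtain ⟨b, rfl⟩ := I.mkHom_surjective y
    exact (congrArg I.mkHom (star_add a b)).trans (map_add I.mkHom _ _)

/-- The quotient map `A → A / I`. -/
def proj : A →⋆ₐ[ℂ] I.Quotient := { I.mkHom with map_star' := fun _ => rfl }

theorem proj_surjective : Function.Surjective I.proj := Ideal.Quotient.mk_surjective

theorem proj_eq_iff (a b : A) : I.proj a = I.proj b ↔ a - b ∈ I.ideal :=
  I.mkHom_eq_iff a b

theorem norm_proj_le (a : A) : ‖I.proj a‖ ≤ ‖a‖ := Ideal.Quotient.norm_mk_le I.ideal a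

theorem exists_norm_proj_lt (x : I.Quotient) {ε : ℝ} (hε : 0 < ε) :
    ∃ a : A, I.proj a = x ∧ ‖a‖ < ‖x‖ + ε := Ideal.Quotient.norm_mk_lt x hε

instance : StarModule ℂ I.Quotient where
  star_smul := by
    intro c x
    obtain ⟨a, rfl⟩ := I.proj_surjective x
    rw [← map_smul, ← map_star, ← map_star, star_smul, map_smul]

/-- An approximate unit of a closed ideal, evaluated at one of its elements. -/
theorem exists_approx (i : A) (hi : i ∈ I.ideal) {ε : ℝ} (hε : 0 < ε) :
    ∃ w : A, 1 - w ∈ I.ideal ∧ ‖w‖ ≤ 1 ∧ ‖i * w‖ ≤ ε := by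
  set c : ℝ := ε ^ 2 with hc
  have hc0 : 0 < c := by positivity
  set h : A := star i * i with hh
  have hsa : IsSelfAdjoint h := IsSelfAdjoint.star_mul_self i
  have hpos : ∀ t : ℝ, 0 < c ^ 2 + t ^ 2 := fun t => by positivity
  have hf : Continuous (fun t : ℝ => c ^ 2 / (c ^ 2 + t ^ 2)) :=
    continuous_const.div (by fun_prop) (fun t => (hpos t).ne')
  have hg : Continuous (fun t : ℝ => t / (c ^ 2 + t ^ 2)) :=
    continuous_id.div (by fun_prop) (fun t => (hpos t).ne')
  set w : A := cfc (fun t : ℝ => c ^ 2 / (c ^ 2 + t ^ 2)) h with hw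
  have hwsa : star w = w := (cfc_predicate _ h : IsSelfAdjoint w)
  have hwn : ‖w‖ ≤ 1 := by
    refine norm_cfc_le zero_le_one fun t _ => ?_
    rw [Real.norm_of_nonneg (by have := hpos t; positivity), div_le_one (hpos t)]
    nlinarith [sq_nonneg t]
  have h1 : 1 - w = h * cfc (fun t : ℝ => t / (c ^ 2 + t ^ 2)) h := by
    have e1 : (1 : A) = cfc (fun _ : ℝ => (1 : ℝ)) h := (cfc_const_one ℝ h).symm
    have e2 : h = cfc (fun t : ℝ => t) h := (cfc_id' ℝ h).symm
    conv_lhs => rw [e1, hw]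
    conv_rhs => lhs; rw [e2]
    rw [← cfc_sub _ _ h continuousOn_const hf.continuousOn,
      ← cfc_mul _ _ h continuous_id'.continuousOn hg.continuousOn]
    refine cfc_congr fun t _ => ?_
    have := (hpos t).ne'
    field_simp
    ring
  have h2 : ‖h * w‖ ≤ c := by
    have e2 : h = cfc (fun t : ℝ => t) h := (cfc_id' ℝ h).symm
    have : h * w = cfc (fun t : ℝ => t * (c ^ 2 / (c ^ 2 + t ^ 2))) h := by
      conv_lhs => lhs; rw [e2]
      rw [hw, ← cfc_mul _ _ h continuous_id'.continuousOn hf.continuousOn]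
    rw [this]
    refine norm_cfc_le hc0.le fun t _ => ?_
    have h0 := hpos t
    rw [norm_mul, Real.norm_of_nonneg (div_nonneg (sq_nonneg c) h0.le), Real.norm_eq_abs,
      ← mul_div_assoc, div_le_iff₀ h0, ← sq_abs t]
    nlinarith [sq_nonneg (|t| - c), abs_nonneg t]
  refine ⟨w, ?_, hwn, ?_⟩
  · rw [h1]
    exact I.ideal.mul_mem_right _ (I.ideal.mul_mem_left _ hi)
  · have : ‖i * w‖ * ‖i * w‖ ≤ ε * ε := by
      rw [← CStarRing.norm_star_mul_self, star_mul, hwsa]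
      calc ‖w * star i * (i * w)‖ = ‖w * (h * w)‖ := by rw [hh]; congr 1; ring
        _ ≤ ‖w‖ * ‖h * w‖ := norm_mul_le _ _
        _ ≤ 1 * c := by gcongr
        _ = ε * ε := by rw [hc]; ring
    exact le_of_sq_le_sq (by simpa [sq] using this) hε.le

instance : CStarRing I.Quotient where
  norm_mul_self_le := by
    intro x
    obtain ⟨a, rfl⟩ := I.proj_surjective x
    refine le_of_forall_pos_le_add fun ε hε => ?_
    obtain ⟨b, hb, hbn⟩ := I.exists_norm_proj_lt (star (I.proj a) * I.proj a) (half_pos hε)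
    have hi : b - star a * a ∈ I.ideal := by
      rw [← proj_eq_iff, hb, map_mul, map_star]
    obtain ⟨w, hw, hw1, hiw⟩ := I.exists_approx _ hi (half_pos hε)
    have haw : I.proj a = I.proj (a * w) := by
      rw [proj_eq_iff, ← mul_one_sub]
      exact I.ideal.mul_mem_left _ hw
    have key : ‖a * w‖ * ‖a * w‖ ≤ ‖b‖ + ε / 2 := by
      rw [← CStarRing.norm_star_mul_self]
      calc ‖star (a * w) * (a * w)‖
          = ‖star w * b * w - star w * ((b - star a * a) * w)‖ := by
            rw [star_mul]; congr 1; ring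
        _ ≤ ‖star w * b * w‖ + ‖star w * ((b - star a * a) * w)‖ := norm_sub_le _ _
        _ ≤ ‖star w‖ * ‖b‖ * ‖w‖ + ‖star w‖ * ‖(b - star a * a) * w‖ :=
            add_le_add (norm_mul₃_le) (norm_mul_le _ _)
        _ ≤ 1 * ‖b‖ * 1 + 1 * (ε / 2) := by
            rw [norm_star]; gcongr
        _ = ‖b‖ + ε / 2 := by ring
    have hle := I.norm_proj_le (a * w)
    rw [← haw] at hle
    calc ‖I.proj a‖ * ‖I.proj a‖ ≤ ‖a * w‖ * ‖a * w‖ := by gcongr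
      _ ≤ ‖b‖ + ε / 2 := key
      _ ≤ _ := by linarith

instance : CommCStarAlgebra I.Quotient where

end CStarIdeal

namespace CStarIdeal
variable {A : Type u} [CommCStarAlgebra A]

/-- The annihilator `I^⊥` of `I`: the largest ideal that meets `I` trivially. -/
def orthogonal (I : CStarIdeal A) : CStarIdeal A where
  ideal :=
    { carrier := {a | ∀ b ∈ I.ideal, a * b = 0}
      add_mem' := fun ha hb c hc => by rw [add_mul, ha c hc, hb c hc, add_zero]
      zero_mem' := fun b _ => zero_mul b
      smul_mem' := fun c a ha b hb => by rw [smul_eq_mul, mul_assoc, ha b hb, mul_zero] }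
  isClosed := by
    have : {a : A | ∀ b ∈ I.ideal, a * b = 0} = ⋂ b ∈ I.ideal, {a | a * b = 0} := by
      ext; simp
    change IsClosed {a : A | ∀ b ∈ I.ideal, a * b = 0}
    rw [this]
    exact isClosed_biInter fun b _ => isClosed_eq (by fun_prop) continuous_const
  star_mem := fun a ha b hb => by
    have := ha (star b) (I.star_mem b hb)
    rw [← star_star (star a * b), star_mul, star_star, mul_comm, this, star_zero]

theorem isGreatest_orthogonal (I : CStarIdeal A) :
    IsGreatest {J : Ideal A | I.ideal ⊓ J = ⊥} I.orthogonal.ideal := by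
  constructor
  · refine le_antisymm (fun a ha => ?_) bot_le
    have h := ha.2 (star a) (I.star_mem a ha.1)
    exact (Submodule.mem_bot A).2 ((CStarRing.mul_star_self_eq_zero_iff a).1 h)
  · intro J hJ a ha b hb
    have : a * b ∈ I.ideal ⊓ J := ⟨I.ideal.mul_mem_left a hb, J.mul_mem_right b ha⟩
    rw [hJ] at this
    exact (Submodule.mem_bot A).1 this

end CStarIdeal

section AdjoinUnit
variable {A : Type u} [CommCStarAlgebra A] (δ : A →⋆ₙₐ[ℂ] A)

/-- The ideal `ker δ`. -/
def kernelIdeal : CStarIdeal A where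
  ideal :=
    { carrier := {a | δ a = 0}
      add_mem' := fun {a b} (ha : δ a = 0) (hb : δ b = 0) => by
        change δ (a + b) = 0
        rw [map_add, ha, hb, add_zero]
      zero_mem' := map_zero δ
      smul_mem' := fun c a (ha : δ a = 0) => by
        change δ (c * a) = 0
        rw [map_mul, ha, mul_zero] }
  isClosed := isClosed_eq (f := δ) (g := fun _ => (0 : A))
    (AddMonoidHomClass.continuous_of_bound δ 1 fun a => by
      simpa using NonUnitalStarAlgHom.norm_apply_le δ a) continuous_const
  star_mem := fun a (ha : δ a = 0) => by
    change δ (star a) = 0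
    rw [map_star, ha, star_zero]

/-- The algebra `A⁺ = A / I ⊕ A / I^⊥` with `I = ker δ`. -/
abbrev KernelUnitization : Type u :=
  (kernelIdeal δ).Quotient × (kernelIdeal δ).orthogonal.Quotient

namespace KernelUnitization

/-- The embedding `a ↦ (a + I) ⊕ (a + I^⊥)`. -/
def embed : A →⋆ₐ[ℂ] KernelUnitization δ :=
  (kernelIdeal δ).proj.prod (kernelIdeal δ).orthogonal.proj

theorem embed_injective : Function.Injective (embed δ) := by
  rw [injective_iff_map_eq_zero]
  intro a ha
  have h1 : (kernelIdeal δ).proj a = (kernelIdeal δ).proj 0 := by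
    rw [map_zero]; exact congrArg Prod.fst ha
  have h2 : (kernelIdeal δ).orthogonal.proj a = (kernelIdeal δ).orthogonal.proj 0 := by
    rw [map_zero]; exact congrArg Prod.snd ha
  rw [CStarIdeal.proj_eq_iff, sub_zero] at h1 h2
  have h3 : a ∈ (kernelIdeal δ).ideal ⊓ (kernelIdeal δ).orthogonal.ideal := ⟨h1, h2⟩
  rw [(kernelIdeal δ).isGreatest_orthogonal.1] at h3
  exact (Submodule.mem_bot A).1 h3

/-- The map `a + I ↦ δ(a)`. -/
def lift : (kernelIdeal δ).Quotient →⋆ₙₐ[ℂ] A where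
  toFun := Quotient.lift δ (by
    intro a b hab
    have h : δ (a - b) = 0 := (Submodule.quotientRel_def _).1 hab
    rwa [map_sub, sub_eq_zero] at h)
  map_smul' := by
    intro c x
    obtain ⟨a, rfl⟩ := (kernelIdeal δ).proj_surjective x
    exact map_smul δ c a
  map_zero' := map_zero δ
  map_add' := by
    intro x y
    obtain ⟨a, rfl⟩ := (kernelIdeal δ).proj_surjective x
    obtain ⟨b, rfl⟩ := (kernelIdeal δ).proj_surjective y
    exact map_add δ a b
  map_mul' := by
    intro x y
    obtain ⟨a, rfl⟩ := (kernelIdeal δ).proj_surjective x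
    obtain ⟨b, rfl⟩ := (kernelIdeal δ).proj_surjective y
    exact map_mul δ a b
  map_star' := by
    intro x
    obtain ⟨a, rfl⟩ := (kernelIdeal δ).proj_surjective x
    exact map_star δ a

theorem lift_proj (a : A) : lift δ ((kernelIdeal δ).proj a) = δ a := rfl

/-- The endomorphism `(a + I) ⊕ (b + I^⊥) ↦ (δ(a) + I) ⊕ (δ(a) + I^⊥)` of `A⁺`. -/
def endo : KernelUnitization δ →⋆ₙₐ[ℂ] KernelUnitization δ :=
  (embed δ : A →⋆ₙₐ[ℂ] KernelUnitization δ).comp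
    ((lift δ).comp (NonUnitalStarAlgHom.fst ℂ _ _))

theorem endo_apply (a b : A) :
    endo δ ((kernelIdeal δ).proj a, (kernelIdeal δ).orthogonal.proj b) = embed δ (δ a) := rfl

/-- The unit `q = (0 + I) ⊕ (1 + I^⊥)` of the kernel of the endomorphism of `A⁺`. -/
def unit : KernelUnitization δ := (0, 1)

theorem isStarProjection_unit : IsStarProjection (unit δ) where
  isIdempotentElem := by simp [IsIdempotentElem, unit]
  isSelfAdjoint := by simp [IsSelfAdjoint, unit, Prod.star_def]

theorem endo_unit : endo δ (unit δ) = 0 := by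
  change embed δ (lift δ 0) = 0
  rw [map_zero, map_zero]

theorem unit_mul_of_endo_eq_zero (x : KernelUnitization δ) (hx : endo δ x = 0) :
    unit δ * x = x := by
  obtain ⟨x, y⟩ := x
  obtain ⟨a, rfl⟩ := (kernelIdeal δ).proj_surjective x
  have h : δ a = 0 := embed_injective δ ((hx : embed δ (δ a) = 0).trans (map_zero _).symm)
  have h' : (kernelIdeal δ).proj a = (kernelIdeal δ).proj 0 := by
    rw [CStarIdeal.proj_eq_iff, sub_zero]; exact h
  rw [h', map_zero]
  simp [unit]

end KernelUnitization
end AdjoinUnit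

section Corner
variable {C : Type u} [CommCStarAlgebra C]

/-- The subalgebra `pCp = pC` of `C`. -/
def cornerSubalgebra (p : C) (hp : IsStarProjection p) : NonUnitalStarSubalgebra ℂ C where
  carrier := {a | p * a = a}
  add_mem' := fun {a b} (ha : p * a = a) (hb : p * b = b) => by
    change p * (a + b) = a + b
    rw [mul_add, ha, hb]
  zero_mem' := mul_zero p
  mul_mem' := fun {a b} (ha : p * a = a) _ => by
    change p * (a * b) = a * b
    rw [← mul_assoc, ha]
  smul_mem' := fun c a (ha : p * a = a) => by
    change p * (c • a) = c • a
    rw [mul_smul_comm, ha]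
  star_mem' := fun {a} (ha : p * a = a) => by
    change p * star a = star a
    conv_lhs => rw [← hp.isSelfAdjoint.star_eq, ← star_mul, mul_comm, ha]

/-- The corner `pCp = pC` of a projection `p`, with unit `p`. -/
def Corner (p : C) (hp : IsStarProjection p) : Type u := cornerSubalgebra p hp

namespace Corner
variable (p : C) (hp : IsStarProjection p)

instance : IsClosed (cornerSubalgebra p hp : Set C) :=
  isClosed_eq (f := fun a => p * a) (g := fun a => a) (by fun_prop) continuous_id

instance : NonUnitalCommCStarAlgebra (Corner p hp) :=
  inferInstanceAs (NonUnitalCommCStarAlgebra (cornerSubalgebra p hp))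

instance : One (Corner p hp) := ⟨⟨p, hp.isIdempotentElem⟩⟩

theorem one_mul' (a : Corner p hp) : 1 * a = a := Subtype.ext a.2

instance : CommRing (Corner p hp) :=
  { (inferInstance : NonUnitalCommRing (Corner p hp)), (inferInstance : One (Corner p hp)) with
    one_mul := one_mul' p hp
    mul_one := fun a => (mul_comm a 1).trans (one_mul' p hp a) }

instance : NormedCommRing (Corner p hp) :=
  { (inferInstance : NonUnitalNormedCommRing (Corner p hp)),
    (inferInstance : CommRing (Corner p hp)) with }

instance : Algebra ℂ (Corner p hp) :=
  Algebra.ofModule (fun c a b => smul_mul_assoc c a b) (fun c a b => mul_smul_comm c a b)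

instance : NormedAlgebra ℂ (Corner p hp) where
  norm_smul_le := fun c a => norm_smul_le c a.1

instance : StarRing (Corner p hp) :=
  { (inferInstance : InvolutiveStar (Corner p hp)) with
    star_mul := fun a b => star_mul a b
    star_add := fun a b => star_add a b }

instance : CommCStarAlgebra (Corner p hp) where
  complete := CompleteSpace.complete
  norm_mul_self_le := CStarRing.norm_mul_self_le
  star_smul := fun c a => Subtype.ext (star_smul c a.1)

end Corner
end Corner

namespace CStarLimit
variable {E : ℕ → Type u} [∀ n, CommCStarAlgebra (E n)] (ψ : ∀ n, E n →⋆ₐ[ℂ] E (n + 1))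

/-- The sequences that are eventually threads of the direct sequence. -/
def threads : StarSubalgebra ℂ (∀ n, E n) where
  carrier := {a | ∀ᶠ n in atTop, ψ n (a n) = a (n + 1)}
  mul_mem' := fun {a b} ha hb => by
    filter_upwards [ha, hb] with n h1 h2
    simp [h1, h2]
  add_mem' := fun {a b} ha hb => by
    filter_upwards [ha, hb] with n h1 h2
    simp [h1, h2]
  algebraMap_mem' := fun r => Eventually.of_forall fun n => AlgHomClass.commutes (ψ n) r
  star_mem' := fun {a} ha => by
    filter_upwards [ha] with n h1
    simp [map_star, h1]

/-- The *-algebra of eventual threads, seminormed by `lim ‖aₙ‖`. -/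
def Pre : Type u := threads ψ

namespace Pre

instance : CommRing (Pre ψ) := inferInstanceAs (CommRing (threads ψ))
instance : StarRing (Pre ψ) := inferInstanceAs (StarRing (threads ψ))
instance : Algebra ℂ (Pre ψ) := inferInstanceAs (Algebra ℂ (threads ψ))
instance : StarModule ℂ (Pre ψ) := inferInstanceAs (StarModule ℂ (threads ψ))

variable {ψ}
theorem exists_tendsto (a : Pre ψ) : ∃ r : ℝ, Tendsto (fun n => ‖a.1 n‖) atTop (𝓝 r) := by
  obtain ⟨N, hN⟩ := eventually_atTop.1 a.2
  have hanti : Antitone fun k => ‖a.1 (k + N)‖ := antitone_nat_of_succ_le fun k => by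
    have := hN (k + N) (by omega)
    rw [show k + 1 + N = k + N + 1 by omega, ← this]
    exact NonUnitalStarAlgHom.norm_apply_le (ψ (k + N)) _
  have hbdd : BddBelow (Set.range fun k => ‖a.1 (k + N)‖) :=
    ⟨0, by rintro _ ⟨k, rfl⟩; exact norm_nonneg _⟩
  exact ⟨_, (tendsto_add_atTop_iff_nat N).1 (tendsto_atTop_ciInf hanti hbdd)⟩

/-- `lim ‖aₙ‖`. -/
def seminorm (a : Pre ψ) : ℝ := limUnder atTop fun n => ‖a.1 n‖

theorem tendsto_seminorm (a : Pre ψ) :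
    Tendsto (fun n => ‖a.1 n‖) atTop (𝓝 (seminorm a)) :=
  tendsto_nhds_limUnder (exists_tendsto a)

/-- `seminorm` as a ring seminorm. -/
def ringSeminorm : RingSeminorm (Pre ψ) where
  toFun := seminorm
  map_zero' := tendsto_nhds_unique (tendsto_seminorm 0) (by
    refine tendsto_const_nhds.congr fun n => ?_
    exact (norm_zero).symm)
  add_le' := fun a b => le_of_tendsto_of_tendsto' (tendsto_seminorm (a + b))
    ((tendsto_seminorm a).add (tendsto_seminorm b)) fun n => norm_add_le (a.1 n) (b.1 n)
  neg' := fun a => tendsto_nhds_unique (tendsto_seminorm (-a))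
    ((tendsto_seminorm a).congr fun n => (norm_neg (a.1 n)).symm)
  mul_le' := fun a b => le_of_tendsto_of_tendsto' (tendsto_seminorm (a * b))
    ((tendsto_seminorm a).mul (tendsto_seminorm b)) fun n => norm_mul_le (a.1 n) (b.1 n)

instance : SeminormedCommRing (Pre ψ) :=
  { (ringSeminorm (ψ := ψ)).toSeminormedRing with mul_comm := mul_comm }

theorem tendsto_norm (a : Pre ψ) : Tendsto (fun n => ‖a.1 n‖) atTop (𝓝 ‖a‖) :=
  tendsto_seminorm a

instance : NormedAlgebra ℂ (Pre ψ) where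
  norm_smul_le := fun c a => le_of_eq <| tendsto_nhds_unique (tendsto_norm (c • a))
    (((tendsto_norm a).const_mul ‖c‖).congr fun n => (norm_smul c (a.1 n)).symm)

instance : NormedStarGroup (Pre ψ) where
  norm_star_le := fun a => le_of_eq <| tendsto_nhds_unique (tendsto_norm (star a))
    ((tendsto_norm a).congr fun n => (norm_star (a.1 n)).symm)

theorem norm_star_mul_self (a : Pre ψ) : ‖star a * a‖ = ‖a‖ * ‖a‖ :=
  tendsto_nhds_unique (tendsto_norm (star a * a))
    (((tendsto_norm a).mul (tendsto_norm a)).congr fun n =>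
      (CStarRing.norm_star_mul_self (x := a.1 n)).symm)

end Pre

open UniformSpace

/-- The C*-algebraic direct limit of `E 0 → E 1 → E 2 → …`: the Hausdorff completion of the
*-algebra of eventual threads in the seminorm `lim ‖aₙ‖`. -/
abbrev Limit : Type u := Completion (Pre ψ)

namespace Limit
variable {ψ}

theorem uniformContinuous_star : UniformContinuous (star : Pre ψ → Pre ψ) :=
  uniformContinuous_of_continuousAt_zero (starAddEquiv : Pre ψ ≃+ Pre ψ).toAddMonoidHom
    continuous_star.continuousAt

instance : Star (Limit ψ) := ⟨Completion.map star⟩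

theorem coe_star (a : Pre ψ) : ((star a : Pre ψ) : Limit ψ) = star (a : Limit ψ) :=
  (Completion.map_coe uniformContinuous_star a).symm

instance : ContinuousStar (Limit ψ) := ⟨Completion.continuous_map⟩

instance : StarRing (Limit ψ) where
  star_involutive := fun x => by
    induction x using Completion.induction_on with
    | hp => exact isClosed_eq (by fun_prop) (by fun_prop)
    | ih a => rw [← coe_star, ← coe_star, star_star]
  star_mul := fun x y => by
    induction x, y using Completion.induction_on₂ with
    | hp => exact isClosed_eq (by fun_prop) (by fun_prop)
    | ih a b => rw [← Completion.coe_mul, ← coe_star, star_mul, Completion.coe_mul, coe_star,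
        coe_star]
  star_add := fun x y => by
    induction x, y using Completion.induction_on₂ with
    | hp => exact isClosed_eq (by fun_prop) (by fun_prop)
    | ih a b => rw [← Completion.coe_add, ← coe_star, star_add, Completion.coe_add, coe_star,
        coe_star]

instance : CommCStarAlgebra (Limit ψ) where
  norm_mul_self_le := fun x => le_of_eq <| by
    induction x using Completion.induction_on with
    | hp => exact isClosed_eq (by fun_prop) (by fun_prop)
    | ih a => rw [← coe_star, ← Completion.coe_mul, Completion.norm_coe, Completion.norm_coe,
        Pre.norm_star_mul_self]
  star_smul := fun c x => by
    induction x using Completion.induction_on with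
    | hp => exact isClosed_eq (continuous_star.comp (continuous_const_smul c))
              ((continuous_const_smul (star c)).comp continuous_star)
    | ih a => rw [← Completion.coe_smul, ← coe_star, star_smul, Completion.coe_smul, coe_star]

variable (ψ)

/-- The thread `(a, ψ₀ a, ψ₁ ψ₀ a, …)`. -/
def threadFrom (a : E 0) : ∀ n, E n
  | 0 => a
  | n + 1 => ψ n (threadFrom a n)

/-- `threadFrom` as a homomorphism. -/
def preOf : E 0 →⋆ₐ[ℂ] Pre ψ where
  toFun := fun a => ⟨threadFrom ψ a, Eventually.of_forall fun _ => rfl⟩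
  map_one' := Subtype.ext <| funext fun n => by
    induction n with
    | zero => rfl
    | succ n ih => exact (congrArg (ψ n) ih).trans (map_one (ψ n))
  map_mul' := fun a b => Subtype.ext <| funext fun n => by
    induction n with
    | zero => rfl
    | succ n ih => exact (congrArg (ψ n) ih).trans (map_mul (ψ n) _ _)
  map_zero' := Subtype.ext <| funext fun n => by
    induction n with
    | zero => rfl
    | succ n ih => exact (congrArg (ψ n) ih).trans (map_zero (ψ n))
  map_add' := fun a b => Subtype.ext <| funext fun n => by
    induction n with
    | zero => rfl
    | succ n ih => exact (congrArg (ψ n) ih).trans (map_add (ψ n) _ _)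
  commutes' := fun r => Subtype.ext <| funext fun n => by
    induction n with
    | zero => rfl
    | succ n ih => exact (congrArg (ψ n) ih).trans (AlgHomClass.commutes (ψ n) r)
  map_star' := fun a => Subtype.ext <| funext fun n => by
    induction n with
    | zero => rfl
    | succ n ih => exact (congrArg (ψ n) ih).trans (map_star (ψ n) _)

/-- The canonical map of the first algebra of the sequence into the limit. -/
def of : E 0 →⋆ₐ[ℂ] Limit ψ where
  toFun := fun a => (preOf ψ a : Limit ψ)
  map_one' := by rw [map_one]; rfl
  map_mul' := fun a b => by rw [map_mul, Completion.coe_mul]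
  map_zero' := by rw [map_zero]; rfl
  map_add' := fun a b => by rw [map_add, Completion.coe_add]
  commutes' := fun r => by rw [AlgHomClass.commutes]; rfl
  map_star' := fun a => by rw [map_star, coe_star]

variable {ψ}
variable (σ : ∀ n, E (n + 1) →⋆ₙₐ[ℂ] E n)
  (hσ : ∀ n a, σ (n + 1) (ψ (n + 1) a) = ψ n (σ n a))

/-- `(aₙ)ₙ ↦ (σₙ(aₙ₊₁))ₙ` on eventual threads. -/
def preMap : Pre ψ →⋆ₙₐ[ℂ] Pre ψ where
  toFun := fun a => ⟨fun n => σ n (a.1 (n + 1)), by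
    filter_upwards [(tendsto_add_atTop_nat 1).eventually a.2] with n hn
    rw [← hn, hσ]⟩
  map_smul' := fun c a => Subtype.ext <| funext fun n => map_smul (σ n) c (a.1 (n + 1))
  map_zero' := Subtype.ext <| funext fun n => map_zero (σ n)
  map_add' := fun a b => Subtype.ext <| funext fun n => map_add (σ n) _ _
  map_mul' := fun a b => Subtype.ext <| funext fun n => map_mul (σ n) _ _
  map_star' := fun a => Subtype.ext <| funext fun n => map_star (σ n) _

theorem norm_preMap_le (a : Pre ψ) : ‖preMap σ hσ a‖ ≤ ‖a‖ :=
  le_of_tendsto_of_tendsto' (Pre.tendsto_norm _)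
    ((Pre.tendsto_norm a).comp (tendsto_add_atTop_nat 1)) fun n =>
      NonUnitalStarAlgHom.norm_apply_le (σ n) (a.1 (n + 1))

theorem uniformContinuous_preMap : UniformContinuous (preMap σ hσ) :=
  (AddMonoidHomClass.lipschitz_of_bound (preMap σ hσ) 1 fun a => by
    simpa using norm_preMap_le σ hσ a).uniformContinuous

theorem map_coe (a : Pre ψ) : Completion.map (preMap σ hσ) a = (preMap σ hσ a : Limit ψ) :=
  Completion.map_coe (uniformContinuous_preMap σ hσ) a

/-- The endomorphism of the direct limit induced by compatible maps `σₙ : E (n + 1) → E n`. -/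
def map : Limit ψ →⋆ₙₐ[ℂ] Limit ψ where
  toFun := Completion.map (preMap σ hσ)
  map_smul' := fun c x => by
    have := Completion.continuous_map (f := preMap σ hσ)
    induction x using Completion.induction_on with
    | hp => exact isClosed_eq (this.comp (continuous_const_smul c))
              ((continuous_const_smul c).comp this)
    | ih a =>
      rw [← Completion.coe_smul, map_coe, map_coe, map_smul, Completion.coe_smul]
      rfl
  map_zero' := by
    rw [← Completion.coe_zero, map_coe, map_zero]
  map_add' := fun x y => by
    have := Completion.continuous_map (f := preMap σ hσ)
    induction x, y using Completion.induction_on₂ with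
    | hp => exact isClosed_eq (by fun_prop) (by fun_prop)
    | ih a b => rw [← Completion.coe_add, map_coe, map_coe, map_coe, map_add, Completion.coe_add]
  map_mul' := fun x y => by
    have := Completion.continuous_map (f := preMap σ hσ)
    induction x, y using Completion.induction_on₂ with
    | hp => exact isClosed_eq (by fun_prop) (by fun_prop)
    | ih a b => rw [← Completion.coe_mul, map_coe, map_coe, map_coe, map_mul, Completion.coe_mul]
  map_star' := fun x => by
    have := Completion.continuous_map (f := preMap σ hσ)
    induction x using Completion.induction_on with
    | hp => exact isClosed_eq (by fun_prop) (by fun_prop)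
    | ih a => rw [← coe_star, map_coe, map_coe, map_star, coe_star]

end Limit


end CStarLimit

section Tower
variable {C : Type u} [CommCStarAlgebra C] (D : C →⋆ₙₐ[ℂ] C)

theorem isStarProjection_iterate_one (k : ℕ) : IsStarProjection (D^[k] 1) := by
  induction k with
  | zero => exact IsStarProjection.one C
  | succ k ih => rw [Function.iterate_succ_apply']; exact ih.map D

theorem iterate_one_mul_succ (k : ℕ) : D^[k] 1 * D^[k + 1] 1 = D^[k + 1] 1 := by
  induction k with
  | zero => simp
  | succ k ih =>
    rw [Function.iterate_succ_apply', Function.iterate_succ_apply' D (k + 1), ← map_mul, ih]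

/-- The family `(q, q δ(1), …, q δⁿ⁻¹(1), δⁿ(1))`. -/
def stageUnit (q : C) (n : ℕ) : Fin (n + 1) → C := fun k =>
  if (k : ℕ) < n then q * D^[k] 1 else D^[k] 1

theorem isStarProjection_stageUnit {q : C} (hq : IsStarProjection q) (n : ℕ) : IsStarProjection (stageUnit D q n) := by
  have h : ∀ k, IsStarProjection (stageUnit D q n k) := fun k => by
    unfold stageUnit
    have h2 := isStarProjection_iterate_one D k
    split_ifs
    · exact ⟨hq.isIdempotentElem.mul h2.isIdempotentElem,
        hq.isSelfAdjoint.mul h2.isSelfAdjoint⟩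
    · exact h2
  exact ⟨funext fun k => (h k).isIdempotentElem, funext fun k => (h k).isSelfAdjoint⟩

/-- The algebra `Bₙ = qA₀ ⊕ … ⊕ qAₙ₋₁ ⊕ Aₙ`, where `Aₖ = δᵏ(1) C δᵏ(1)`: the families
`(a₀, …, aₙ)` in `C` with `aₖ ∈ q δᵏ(1) C` for `k < n` and `aₙ ∈ δⁿ(1) C`. -/
abbrev Stage {q : C} (hq : IsStarProjection q) (n : ℕ) : Type u := Corner (stageUnit D q n) (isStarProjection_stageUnit D hq n)

namespace Stage

theorem unit_mul {D : C →⋆ₙₐ[ℂ] C} {q : C} {hq : IsStarProjection q} {n : ℕ} (a : Stage D hq n) (k : Fin (n + 1)) :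
    stageUnit D q n k * a.1 k = a.1 k := congrFun a.2 k

/-- `(a₀, …, aₙ) ↦ (a₀, …, aₙ₋₁, q aₙ, δ(aₙ))`. -/
def bondFun (q : C) (n : ℕ) (a : Fin (n + 1) → C) : Fin (n + 2) → C := fun k =>
  if h : (k : ℕ) < n + 1 then
    if (k : ℕ) < n then a ⟨k, h⟩ else q * a ⟨k, h⟩
  else D (a (Fin.last n))

theorem bondFun_mul {q : C} (hq : IsStarProjection q) (n : ℕ) (a b : Fin (n + 1) → C) :
    bondFun D q n (a * b) = bondFun D q n a * bondFun D q n b := by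
  funext k
  simp only [bondFun, Pi.mul_apply]
  split_ifs
  · rfl
  · conv_lhs => rw [← hq.isIdempotentElem.eq]
    ring
  · exact map_mul D _ _

theorem bondFun_unit (q : C) (n : ℕ) : bondFun D q n (stageUnit D q n) = stageUnit D q (n + 1) := by
  funext k
  have hk := k.2
  simp only [bondFun, stageUnit]
  split_ifs with h1 h2 h3
  · rfl
  · rfl
  · simp at h3
  · have : (k : ℕ) = n + 1 := by omega
    rw [this, Function.iterate_succ_apply', Fin.val_last]

variable {q : C} (hq : IsStarProjection q)

/-- The connecting map `δₙ : Bₙ → Bₙ₊₁` given by `bondFun`. -/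
def bond (n : ℕ) : Stage D hq n →⋆ₐ[ℂ] Stage D hq (n + 1) where
  toFun := fun a => ⟨bondFun D q n a.1, by
    change stageUnit D q (n + 1) * bondFun D q n a.1 = bondFun D q n a.1
    rw [← bondFun_unit, ← bondFun_mul D hq]
    exact congrArg _ a.2⟩
  map_one' := Subtype.ext (bondFun_unit D q n)
  map_mul' := fun a b => Subtype.ext (bondFun_mul D hq n a.1 b.1)
  map_zero' := Subtype.ext <| funext fun k => by
    change bondFun D q n 0 k = 0
    simp [bondFun]
  map_add' := fun a b => Subtype.ext <| funext fun k => by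
    change bondFun D q n (a.1 + b.1) k = bondFun D q n a.1 k + bondFun D q n b.1 k
    simp only [bondFun, Pi.add_apply]
    split_ifs
    · rfl
    · exact mul_add _ _ _
    · exact map_add D _ _
  commutes' := fun r => Subtype.ext <| funext fun k => by
    change bondFun D q n (r • stageUnit D q n) k = r • stageUnit D q (n + 1) k
    rw [← bondFun_unit]
    simp only [bondFun, Pi.smul_apply]
    split_ifs
    · rfl
    · exact mul_smul_comm _ _ _
    · exact map_smul D _ _
  map_star' := fun a => Subtype.ext <| funext fun k => by
    change bondFun D q n (star a.1) k = star (bondFun D q n a.1 k)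
    simp only [bondFun, Pi.star_apply]
    split_ifs
    · rfl
    · rw [star_mul, hq.isSelfAdjoint.star_eq, mul_comm]
    · exact map_star D _

/-- The left shift `Bₙ₊₁ → Bₙ`, `(a₀, a₁, …, aₙ₊₁) ↦ (a₁, …, aₙ₊₁)`. -/
def shift (n : ℕ) : Stage D hq (n + 1) →⋆ₙₐ[ℂ] Stage D hq n where
  toFun := fun a => ⟨fun k => a.1 k.succ, funext fun k => by
    change stageUnit D q n k * a.1 k.succ = a.1 k.succ
    have key : stageUnit D q n k * stageUnit D q (n + 1) k.succ
        = stageUnit D q (n + 1) k.succ := by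
      have h := iterate_one_mul_succ D k
      simp only [stageUnit, Fin.val_succ, add_lt_add_iff_right]
      split_ifs
      · rw [mul_mul_mul_comm, hq.isIdempotentElem.eq, h]
      · exact h
    rw [← unit_mul a k.succ, ← mul_assoc, key]⟩
  map_smul' := fun _ _ => rfl
  map_zero' := rfl
  map_add' := fun _ _ => rfl
  map_mul' := fun _ _ => rfl
  map_star' := fun _ => rfl

theorem shift_bond (n : ℕ) (a : Stage D hq (n + 1)) :
    shift D hq (n + 1) (bond D hq (n + 1) a) = bond D hq n (shift D hq n a) :=
  Subtype.ext <| funext fun k => by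
    change bondFun D q (n + 1) a.1 k.succ = bondFun D q n (fun j => a.1 j.succ) k
    simp only [bondFun, Fin.val_succ, add_lt_add_iff_right]
    rfl

/-- The identification of `C` with `B₀`. -/
def zeroHom : C →⋆ₐ[ℂ] Stage D hq 0 where
  toFun := fun a => ⟨fun _ => a, funext fun k => by
    change stageUnit D q 0 k * a = a
    simp [stageUnit]⟩
  map_one' := Subtype.ext <| funext fun k => by
    change 1 = stageUnit D q 0 k
    simp [stageUnit]
  map_mul' := fun _ _ => rfl
  map_zero' := rfl
  map_add' := fun _ _ => rfl
  commutes' := fun r => Subtype.ext <| funext fun k => by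
    change algebraMap ℂ C r = r • stageUnit D q 0 k
    simp [stageUnit, Algebra.algebraMap_eq_smul_one]
  map_star' := fun _ => rfl

end Stage
end Tower

section NaturalExtension
variable {A : Type u} [CommCStarAlgebra A] (δ : A →⋆ₙₐ[ℂ] A)

/-- The algebra `B` of the natural extension of `(A, δ)`: the direct limit of the algebras `Bₙ` built
from `A⁺`, its endomorphism and the unit of the kernel of that endomorphism. -/
abbrev NaturalExtension : Type u :=
  CStarLimit.Limit (Stage.bond (KernelUnitization.endo δ)
    (KernelUnitization.isStarProjection_unit δ))

namespace NaturalExtension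

/-- The inclusion `A ⊆ A⁺ = B₀ ⊆ B`. -/
def embed : A →⋆ₐ[ℂ] NaturalExtension δ :=
  (CStarLimit.Limit.of _).comp
    ((Stage.zeroHom (KernelUnitization.endo δ) (KernelUnitization.isStarProjection_unit δ)).comp
      (KernelUnitization.embed δ))

/-- The endomorphism of `B` induced by the left shifts `Bₙ₊₁ → Bₙ`. -/
def endo : NaturalExtension δ →⋆ₙₐ[ℂ] NaturalExtension δ :=
  CStarLimit.Limit.map
    (Stage.shift (KernelUnitization.endo δ) (KernelUnitization.isStarProjection_unit δ))
    (Stage.shift_bond (KernelUnitization.endo δ) (KernelUnitization.isStarProjection_unit δ))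

theorem endo_embed (a : A) : endo δ (embed δ a) = embed δ (δ a) := by
  refine (CStarLimit.Limit.map_coe _ _ _).trans (congrArg _ (Subtype.ext <| funext fun n => ?_))
  induction n with
  | zero => rfl
  | succ n ih => exact (Stage.shift_bond _ _ n _).trans (congrArg _ ih)

end NaturalExtension
end NaturalExtension

/-- `δs` is the complete transfer operator of `(B, δ)`: the kernel of `δ` has a unit `q`, and `δs` is
`b ↦ δ⁻¹(δ(1) b δ(1))`, where `δ⁻¹` is the inverse of the injective map `δ : (1 - q)B → δ(B)`. -/
def IsCompleteTransferOperator {B : Type u} [CStarAlgebra B] (δ : B →⋆ₙₐ[ℂ] B) (δs : B → B) : Prop :=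
  ∃ q : B, δ q = 0 ∧ (∀ b, δ b = 0 → q * b = b ∧ b * q = b) ∧
    ∀ b, (1 - q) * δs b = δs b ∧ δ (δs b) = δ 1 * b * δ 1

/-- A partial dynamical system on `X`: a continuous map `α : Δ₁ → X` with `Δ₁ ⊆ X` clopen. -/
structure PartialSystem (X : Type v) [TopologicalSpace X] where
  dom : Set X
  isClopen_dom : IsClopen dom
  map : dom → X
  continuous_map : Continuous map

namespace PartialSystem
variable {X : Type v} [TopologicalSpace X] (S : PartialSystem X)

/-- `S` is the partial dynamical system generated by `(A, δ)`, when `X` is identified with the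
spectrum of `A` through `e`, that is, when `a(x)` stands for `e x a`:
`δ(a)(x) = a(α(x))` for `x ∈ Δ₁` and `δ(a)(x) = 0` for `x ∉ Δ₁`. -/
def GeneratedBy {A : Type u} [CommCStarAlgebra A] (δ : A →⋆ₙₐ[ℂ] A)
    (e : X ≃ₜ WeakDual.characterSpace ℂ A) : Prop :=
  ∀ (x : X) (a : A), (∀ hx : x ∈ S.dom, e x (δ a) = e (S.map ⟨x, hx⟩) a) ∧
    (x ∉ S.dom → e x (δ a) = 0)

/-- The image `Δ₋₁ = α(Δ₁)`. -/
def image : Set X := Set.range S.map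

/-- The domain `Δₙ` of `αⁿ`. -/
def iterDom : ℕ → Set X
  | 0 => Set.univ
  | n + 1 => {x | ∃ hx : x ∈ S.dom, S.map ⟨x, hx⟩ ∈ iterDom n}

/-- `y = x` and `z = α(x)` for some `x ∈ Δ₁`. The point `Sum.inr ()` is the abstract point `0`. -/
def IsStep (y z : X ⊕ Unit) : Prop :=
  ∃ (x : X) (hx : x ∈ S.dom), y = Sum.inl x ∧ z = Sum.inl (S.map ⟨x, hx⟩)

/-- `X_N`: the sequences `(x₀, …, x_N, 0, 0, …)` with `xₙ ∈ Δₙ`, `α(xₙ) = xₙ₋₁` and `x_N` in the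
closure of `X ∖ Δ₋₁`. -/
def finiteAntiOrbits (N : ℕ) : Set (ℕ → X ⊕ Unit) :=
  {x | (∀ n ≤ N, ∃ y ∈ S.iterDom n, x n = Sum.inl y) ∧
    (∀ n < N, S.IsStep (x (n + 1)) (x n)) ∧
    (∃ y ∈ closure (S.imageᶜ), x N = Sum.inl y) ∧
    ∀ n, N < n → x n = Sum.inr ()}

/-- `X_∞`: the sequences `(x₀, x₁, …)` with `xₙ ∈ Δₙ` and `α(xₙ) = xₙ₋₁`. -/
def infiniteAntiOrbits : Set (ℕ → X ⊕ Unit) :=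
  {x | (∀ n, ∃ y ∈ S.iterDom n, x n = Sum.inl y) ∧ ∀ n, S.IsStep (x (n + 1)) (x n)}

/-- The space `⋃ X_N ∪ X_∞`, with the topology inherited from the product of copies of `X ∪ {0}`,
in which `{0}` is clopen. -/
def extSpace : Set (ℕ → X ⊕ Unit) :=
  (⋃ N, S.finiteAntiOrbits N) ∪ S.infiniteAntiOrbits

open Classical in
/-- `α` as a map on `X ∪ {0}`, with value `0` off `Δ₁`. -/
def pointMap : X ⊕ Unit → X ⊕ Unit
  | Sum.inl x => if hx : x ∈ S.dom then Sum.inl (S.map ⟨x, hx⟩) else Sum.inr ()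
  | Sum.inr _ => Sum.inr ()

theorem pointMap_inl (x : X) (hx : x ∈ S.dom) :
    S.pointMap (Sum.inl x) = Sum.inl (S.map ⟨x, hx⟩) := dif_pos hx

theorem continuous_pointMap : Continuous S.pointMap := by
  refine continuous_sum_dom.2 ⟨?_, continuous_const⟩
  have h1 : ContinuousOn (S.pointMap ∘ Sum.inl) S.dom := by
    rw [continuousOn_iff_continuous_domRestrict]
    refine (continuous_inl.comp S.continuous_map).congr fun x => ?_
    exact (S.pointMap_inl x.1 x.2).symm
  have h2 : ContinuousOn (S.pointMap ∘ Sum.inl) S.domᶜ :=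
    (continuousOn_const (c := Sum.inr ())).congr fun x hx => dif_neg hx
  rw [continuous_iff_continuousAt]
  intro x
  by_cases hx : x ∈ S.dom
  · exact h1.continuousAt (S.isClopen_dom.isOpen.mem_nhds hx)
  · exact h2.continuousAt (S.isClopen_dom.compl.isOpen.mem_nhds hx)

/-- `(α(x₀), x₀, x₁, …)`. -/
def shiftSeq (x : ℕ → X ⊕ Unit) : ℕ → X ⊕ Unit
  | 0 => S.pointMap (x 0)
  | n + 1 => x n

theorem continuous_shiftSeq : Continuous S.shiftSeq := by
  refine continuous_pi fun n => ?_
  cases n with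
  | zero => exact S.continuous_pointMap.comp (continuous_apply 0)
  | succ n => exact continuous_apply n

/-- The sequences with `x₀ ∈ Δ₁`. -/
def extDom : Set S.extSpace := {x | ∃ y ∈ S.dom, x.1 0 = Sum.inl y}

/-- The sequences with `x₁ ∈ Δ₁`. -/
def extImage : Set S.extSpace := {x | ∃ y ∈ S.dom, x.1 1 = Sum.inl y}

theorem isClopen_extDom : IsClopen S.extDom := by
  have h : IsClopen (Sum.inl '' S.dom : Set (X ⊕ Unit)) :=
    ⟨IsClosedEmbedding.inl.isClosedMap _ S.isClopen_dom.isClosed,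
      IsOpenEmbedding.inl.isOpenMap _ S.isClopen_dom.isOpen⟩
  have hc : Continuous fun x : S.extSpace => x.1 0 :=
    (continuous_apply 0).comp continuous_subtype_val
  convert h.preimage hc using 1
  ext x
  simp [extDom, eq_comm]

theorem mem_iterDom_shiftSeq {x : ℕ → X ⊕ Unit} (h0 : ∃ y ∈ S.dom, x 0 = Sum.inl y) (n : ℕ)
    (hs : ∀ k < n, S.IsStep (x (k + 1)) (x k)) : ∃ y ∈ S.iterDom (n + 1), x n = Sum.inl y := by
  induction n with
  | zero =>
    obtain ⟨y, hy, e⟩ := h0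
    exact ⟨y, ⟨hy, trivial⟩, e⟩
  | succ n ih =>
    obtain ⟨y, hy, e⟩ := ih fun k hk => hs k (by omega)
    obtain ⟨z, hz, e1, e2⟩ := hs n (by omega)
    have : S.map ⟨z, hz⟩ = y := Sum.inl_injective (e2.symm.trans e)
    exact ⟨z, ⟨hz, this ▸ hy⟩, e1⟩

theorem isStep_shiftSeq {x : ℕ → X ⊕ Unit} (h0 : ∃ y ∈ S.dom, x 0 = Sum.inl y) :
    S.IsStep (S.shiftSeq x 1) (S.shiftSeq x 0) := by
  obtain ⟨y, hy, e⟩ := h0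
  exact ⟨y, hy, e, (congrArg S.pointMap e).trans (S.pointMap_inl y hy)⟩

theorem shiftSeq_mem (x : S.extSpace) (h0 : x ∈ S.extDom) : S.shiftSeq x.1 ∈ S.extSpace := by
  obtain ⟨x, hx⟩ := x
  change ∃ y ∈ S.dom, x 0 = Sum.inl y at h0
  change S.shiftSeq x ∈ S.extSpace
  have hz : ∃ y ∈ S.iterDom 0, S.shiftSeq x 0 = Sum.inl y := by
    obtain ⟨y, hy, e, e'⟩ := S.isStep_shiftSeq h0
    exact ⟨_, trivial, e'⟩
  rcases hx with hx | ⟨_, hx⟩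
  · obtain ⟨N, hN⟩ := Set.mem_iUnion.1 hx
    obtain ⟨h1, h2, h3, h4⟩ := hN
    refine Or.inl (Set.mem_iUnion.2 ⟨N + 1, ?_, ?_, h3, ?_⟩)
    · rintro (_ | n) hn
      · exact hz
      · exact S.mem_iterDom_shiftSeq h0 n fun k hk => h2 k (by omega)
    · rintro (_ | n) hn
      · exact S.isStep_shiftSeq h0
      · exact h2 n (by omega)
    · rintro (_ | n) hn
      · omega
      · exact h4 n (by omega)
  · refine Or.inr ⟨?_, ?_⟩
    · rintro (_ | n)
      · exact hz
      · exact S.mem_iterDom_shiftSeq h0 n fun k _ => hx k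
    · rintro (_ | n)
      · exact S.isStep_shiftSeq h0
      · exact hx n

/-- The natural extension: the shift `(x₀, x₁, …) ↦ (α(x₀), x₀, x₁, …)` on the sequences with `x₀ ∈ Δ₁`. -/
def naturalExtension : PartialSystem S.extSpace where
  dom := S.extDom
  isClopen_dom := S.isClopen_extDom
  map := fun x => ⟨S.shiftSeq x.1.1, S.shiftSeq_mem x.1 x.2⟩
  continuous_map := (S.continuous_shiftSeq.comp
    (continuous_subtype_val.comp continuous_subtype_val)).subtype_mk _

end PartialSystem

end NatExt

end

/-! The left shifts `Bₙ₊₁ → Bₙ` have a partial inverse: prepend a zero and cut down by the unit of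
`Bₙ₊₁`. Both shifts are compatible with the connecting maps, so the limit `B` carries the
endomorphism `d` (left) and a homomorphism `t` (right) with `d (t b) = d 1 * b` and `t (d b) = t 1 *
b`. From stage 1 on the thread of `q` is `(q, 0, …, 0)`, hence `t 1 = 1 - q`. These identities alone
make `t` a complete transfer operator. Moreover `b = q * b + t (d b)`, where `d` makes a thread
start one stage earlier and `q * b` only sees the entry with index 0. Hence `A⁺` and `t` generate
`B`; as `A⁺` is generated by `A` and `q`, a character of `B` is determined by its values on the
elements `tⁿ(a)`, `a ∈ A`.

For a character `χ`, each functional `a ↦ χ(tⁿ(a))` is multiplicative, so it is a point `xₙ` of `X`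
or zero. The identity for `t ∘ d` gives `α(xₙ₊₁) = xₙ` as long as `xₙ₊₁ ≠ 0`. If `x_N` is the last
nonzero term, then `χ(t^N(q)) = 1`, so `x_N` kills every `a` with `q * a = 0`; these `a` form `I^⊥`,
the functions vanishing on the closure of `X ∖ Δ₋₁`, and Urysohn's lemma puts `x_N` in that closure.

Conversely, `tⁿ(b) = 0` forces `b * δⁿ(1) = 0`, so points of `Δₙ` lift to characters along `a ↦
tⁿ(a)`, and suitable end points lift along `a ↦ t^N(q a)`. The second kind of lift realises the
finite sequences; nested compact sets of lifts realise the infinite ones. Thus `χ ↦ (xₙ)` is a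
continuous bijection from a compact space to a Hausdorff space. Since `d (t b) = d 1 * b`, composing
a character with `d` either prepends `α(x₀)` or gives zero. -/

noncomputable section

open Filter Topology

namespace NatExt

/-! ### Direct limits: injectivity and maps that raise the index -/

namespace CStarLimit
open UniformSpace

namespace Limit
variable {E : ℕ → Type u} [∀ n, CommCStarAlgebra (E n)] {ψ : ∀ n, E n →⋆ₐ[ℂ] E (n + 1)}

theorem coe_eq_of_eventually_eq {a b : Pre ψ} (h : ∀ᶠ n in atTop, a.1 n = b.1 n) :
    (a : Limit ψ) = b := by
  have h0 : ‖a - b‖ = 0 := tendsto_nhds_unique (Pre.tendsto_norm (a - b))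
    (tendsto_const_nhds.congr' (h.mono fun n hn => by
      change 0 = ‖a.1 n - b.1 n‖
      rw [hn, sub_self, norm_zero]))
  rw [← sub_eq_zero, ← Completion.coe_sub, ← norm_eq_zero, Completion.norm_coe, h0]

/-- Injective *-homomorphisms of C*-algebras are isometric, so the norm is constant along a thread
and survives in the limit. -/
theorem of_injective (hψ : ∀ n, Function.Injective (ψ n)) : Function.Injective (of ψ) := by
  rw [injective_iff_map_eq_zero]
  intro a ha
  have hn : ∀ n, ‖threadFrom ψ a n‖ = ‖a‖ := fun n => by
    induction n with
    | zero => rfl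
    | succ n ih => exact (NonUnitalStarAlgHom.norm_map (ψ n) (hψ n) _).trans ih
  have h1 : ‖preOf ψ a‖ = ‖a‖ := tendsto_nhds_unique (Pre.tendsto_norm (preOf ψ a))
    (tendsto_const_nhds.congr fun n => (hn n).symm)
  have h2 : ‖(preOf ψ a : Limit ψ)‖ = 0 := by
    rw [show (preOf ψ a : Limit ψ) = 0 from ha, norm_zero]
  rwa [Completion.norm_coe, h1, norm_eq_zero] at h2

variable (ρ : ∀ n, E n →⋆ₙₐ[ℂ] E (n + 1))

/-- `(aₙ)ₙ ↦ (0, ρ₀(a₀), ρ₁(a₁), …)`. -/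
def delay (a : ∀ n, E n) : ∀ n, E n
  | 0 => 0
  | n + 1 => ρ n (a n)

variable (hρ : ∀ n a, ρ (n + 1) (ψ n a) = ψ (n + 1) (ρ n a))

/-- `delay` on eventual threads. -/
def preDelay : Pre ψ →ₙₐ[ℂ] Pre ψ where
  toFun := fun a => ⟨delay ρ a.1, by
    obtain ⟨N, hN⟩ := eventually_atTop.1 a.2
    -- The relation at index `m + 1` comes from the one for `a` at index `m`; the artificial entry 0
    -- at index 0 is not required to fit.
    refine eventually_atTop.2 ⟨N + 1, fun n hn => ?_⟩
    obtain ⟨n, rfl⟩ : ∃ m, n = m + 1 := ⟨n - 1, by omega⟩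
    change ψ (n + 1) (ρ n (a.1 n)) = ρ (n + 1) (a.1 (n + 1))
    rw [← hN n (by omega), hρ]⟩
  map_smul' := fun c a => Subtype.ext <| funext fun n => by
    cases n with
    | zero => exact (smul_zero c).symm
    | succ n => exact map_smul (ρ n) c (a.1 n)
  map_zero' := Subtype.ext <| funext fun n => by
    cases n with
    | zero => rfl
    | succ n => exact map_zero (ρ n)
  map_add' := fun a b => Subtype.ext <| funext fun n => by
    cases n with
    | zero => exact (add_zero (0 : E 0)).symm
    | succ n => exact map_add (ρ n) _ _
  map_mul' := fun a b => Subtype.ext <| funext fun n => by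
    cases n with
    | zero => exact (mul_zero (0 : E 0)).symm
    | succ n => exact map_mul (ρ n) _ _

theorem norm_preDelay_le (a : Pre ψ) : ‖preDelay ρ hρ a‖ ≤ ‖a‖ :=
  le_of_tendsto_of_tendsto' ((Pre.tendsto_norm _).comp (tendsto_add_atTop_nat 1))
    (Pre.tendsto_norm a) fun n => NonUnitalStarAlgHom.norm_apply_le (ρ n) (a.1 n)

theorem uniformContinuous_preDelay : UniformContinuous (preDelay ρ hρ) :=
  (AddMonoidHomClass.lipschitz_of_bound (preDelay ρ hρ) 1 fun a => by
    simpa using norm_preDelay_le ρ hρ a).uniformContinuous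

theorem map_preDelay_coe (a : Pre ψ) :
    Completion.map (preDelay ρ hρ) a = (preDelay ρ hρ a : Limit ψ) :=
  Completion.map_coe (uniformContinuous_preDelay ρ hρ) a

/-- The endomorphism of the direct limit induced by compatible maps `ρₙ : E n → E (n + 1)`. -/
def delayMap : Limit ψ →ₙₐ[ℂ] Limit ψ where
  toFun := Completion.map (preDelay ρ hρ)
  map_smul' := fun c x => by
    have := Completion.continuous_map (f := preDelay ρ hρ)
    induction x using Completion.induction_on with
    | hp => exact isClosed_eq (this.comp (continuous_const_smul c))
              ((continuous_const_smul c).comp this)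
    | ih a =>
      rw [← Completion.coe_smul, map_preDelay_coe, map_preDelay_coe, map_smul,
        Completion.coe_smul]
      rfl
  map_zero' := by
    rw [← Completion.coe_zero, map_preDelay_coe, map_zero]
  map_add' := fun x y => by
    have := Completion.continuous_map (f := preDelay ρ hρ)
    induction x, y using Completion.induction_on₂ with
    | hp => exact isClosed_eq (by fun_prop) (by fun_prop)
    | ih a b =>
      rw [← Completion.coe_add, map_preDelay_coe, map_preDelay_coe, map_preDelay_coe, map_add,
        Completion.coe_add]
  map_mul' := fun x y => by
    have := Completion.continuous_map (f := preDelay ρ hρ)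
    induction x, y using Completion.induction_on₂ with
    | hp => exact isClosed_eq (by fun_prop) (by fun_prop)
    | ih a b =>
      rw [← Completion.coe_mul, map_preDelay_coe, map_preDelay_coe, map_preDelay_coe, map_mul,
        Completion.coe_mul]

theorem delayMap_coe (a : Pre ψ) : delayMap ρ hρ a = (preDelay ρ hρ a : Limit ψ) :=
  map_preDelay_coe ρ hρ a

end Limit
end CStarLimit

/-! ### The right shift on the algebras `Bₙ` -/

section Tower
variable {C : Type u} [CommCStarAlgebra C] (D : C →⋆ₙₐ[ℂ] C)

theorem stageUnit_mul_succ {q : C} (hq : IsStarProjection q) (n : ℕ) (k : Fin (n + 1)) :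
    stageUnit D q n k * stageUnit D q (n + 1) k.succ = stageUnit D q (n + 1) k.succ := by
  have h := iterate_one_mul_succ D k
  simp only [stageUnit, Fin.val_succ, add_lt_add_iff_right]
  split_ifs
  · rw [mul_mul_mul_comm, hq.isIdempotentElem.eq, h]
  · exact h

namespace Stage
variable {q : C} (hq : IsStarProjection q)

theorem bond_apply (n : ℕ) (a : Stage D hq n) : (bond D hq n a).1 = bondFun D q n a.1 := rfl

/-- Only the last entry is altered. It is split into `q * x` and `D x`, and `D x = 0` forces `x = q
* x`, so both parts vanish only for `x = 0`. -/
theorem bond_injective (hker : ∀ x, D x = 0 → q * x = x) (n : ℕ) :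
    Function.Injective (bond D hq n) := by
  rw [injective_iff_map_eq_zero]
  intro a ha
  have h : ∀ k, bondFun D q n a.1 k = 0 := fun k => congrFun (congrArg Subtype.val ha) k
  refine Subtype.ext <| funext fun k => ?_
  change a.1 k = 0
  have h1 := h k.castSucc
  rw [bondFun, dif_pos (by exact k.2)] at h1
  split_ifs at h1 with hk
  · exact h1
  · have h2 := h (Fin.last (n + 1))
    rw [bondFun, dif_neg (by simp)] at h2
    have hkl : k = Fin.last n := Fin.ext (by have := k.2; simp at hk ⊢; omega)
    subst hkl
    rw [← hker _ h2]
    exact h1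

/-- `(a₀, …, aₙ) ↦ (0, δ(1) a₀, …, δⁿ⁺¹(1) aₙ)`. -/
def delayFun (q : C) (n : ℕ) (a : Fin (n + 1) → C) : Fin (n + 2) → C :=
  stageUnit D q (n + 1) * Fin.cons 0 a

/-- The right shift `Bₙ → Bₙ₊₁` given by `delayFun`. -/
def delay (n : ℕ) : Stage D hq n →⋆ₙₐ[ℂ] Stage D hq (n + 1) where
  toFun := fun a => ⟨delayFun D q n a.1, by
    -- Moving an entry from place `k` to `k + 1` leaves it in `δᵏ(1) C` only; the factor `stageUnit`
    -- cuts it down to the smaller corner.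
    change stageUnit D q (n + 1) * delayFun D q n a.1 = delayFun D q n a.1
    rw [delayFun, ← mul_assoc, (isStarProjection_stageUnit D hq (n + 1)).isIdempotentElem.eq]⟩
  map_smul' := fun c a => Subtype.ext <| by
    change delayFun D q n (c • a.1) = c • delayFun D q n a.1
    rw [delayFun, delayFun, ← mul_smul_comm]
    congr 1
    funext k
    refine Fin.cases ?_ (fun k => rfl) k
    exact (smul_zero c).symm
  map_zero' := Subtype.ext <| by
    change delayFun D q n 0 = 0
    rw [delayFun, ← mul_zero (stageUnit D q (n + 1))]
    congr 1
    funext k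
    exact Fin.cases rfl (fun k => rfl) k
  map_add' := fun a b => Subtype.ext <| by
    change delayFun D q n (a.1 + b.1) = delayFun D q n a.1 + delayFun D q n b.1
    rw [delayFun, delayFun, delayFun, ← mul_add]
    congr 1
    funext k
    refine Fin.cases ?_ (fun k => rfl) k
    exact (add_zero 0).symm
  map_mul' := fun a b => Subtype.ext <| by
    change delayFun D q n (a.1 * b.1) = delayFun D q n a.1 * delayFun D q n b.1
    rw [delayFun, delayFun, delayFun, mul_mul_mul_comm,
      (isStarProjection_stageUnit D hq (n + 1)).isIdempotentElem.eq]
    congr 1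
    funext k
    refine Fin.cases ?_ (fun k => rfl) k
    exact (mul_zero 0).symm
  map_star' := fun a => Subtype.ext <| by
    change delayFun D q n (star a.1) = star (delayFun D q n a.1)
    rw [delayFun, delayFun, star_mul, mul_comm,
      (isStarProjection_stageUnit D hq (n + 1)).isSelfAdjoint.star_eq]
    congr 1
    funext k
    refine Fin.cases ?_ (fun k => rfl) k
    exact (star_zero C).symm

theorem delay_apply_zero (n : ℕ) (a : Stage D hq n) : (delay D hq n a).1 0 = 0 := mul_zero _

theorem delay_apply_succ (n : ℕ) (a : Stage D hq n) (k : Fin (n + 1)) :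
    (delay D hq n a).1 k.succ = stageUnit D q (n + 1) k.succ * a.1 k := rfl

theorem delay_bond (n : ℕ) (a : Stage D hq n) :
    delay D hq (n + 1) (bond D hq n a) = bond D hq (n + 1) (delay D hq n a) := by
  refine Subtype.ext <| funext fun k => ?_
  change _ = bondFun D q (n + 1) (delay D hq n a).1 k
  refine Fin.cases ?_ (fun k => ?_) k
  · rw [delay_apply_zero]
    simp [bondFun, delay_apply_zero]
  · rw [delay_apply_succ, ← bondFun_unit D q (n + 1), bond_apply]
    simp only [bondFun, Fin.val_succ, add_lt_add_iff_right]
    split_ifs with h1 h2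
    · rfl
    · change _ * (q * _) = q * (stageUnit D q (n + 1) (Fin.succ ⟨k, h1⟩) * _)
      rw [mul_mul_mul_comm, hq.isIdempotentElem.eq]
      rfl
    · rw [← Fin.succ_last, delay_apply_succ, map_mul]

theorem delay_one_apply_succ (n : ℕ) (k : Fin (n + 1)) :
    (delay D hq n 1).1 k.succ = stageUnit D q (n + 1) k.succ := by
  rw [delay_apply_succ, mul_comm]
  exact stageUnit_mul_succ D hq n k

/-- The two shifts undo each other except that the entry with index 0 is lost, and `delay 1` is the
unit with precisely that entry deleted. -/
theorem delay_shift (n : ℕ) (a : Stage D hq (n + 1)) :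
    delay D hq n (shift D hq n a) = delay D hq n 1 * a := by
  refine Subtype.ext <| funext fun k => ?_
  change _ = (delay D hq n 1).1 k * a.1 k
  refine Fin.cases ?_ (fun k => ?_) k
  · rw [delay_apply_zero, delay_apply_zero, zero_mul]
  · rw [delay_apply_succ, delay_one_apply_succ]
    rfl

theorem threadFrom_zeroHom_apply (c : C) (n : ℕ) (k : Fin (n + 1)) :
    (CStarLimit.Limit.threadFrom (bond D hq) (zeroHom D hq c) n).1 k =
      if (k : ℕ) < n then q * D^[k] c else D^[k] c := by
  induction n with
  | zero =>
    simp
    rfl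
  | succ n ih =>
    change bondFun D q n (CStarLimit.Limit.threadFrom (bond D hq) (zeroHom D hq c) n).1 k = _
    have hk := k.2
    simp only [bondFun, ih]
    split_ifs with h1 h2 h3
    · rfl
    · rfl
    · simp at h3
    · have : (k : ℕ) = n + 1 := by omega
      rw [this, Function.iterate_succ_apply', Fin.val_last]

theorem iterate_apply_unit {x : C} (hx : D x = 0) (k : ℕ) : D^[k + 1] x = 0 := by
  induction k with
  | zero => exact hx
  | succ k ih => rw [Function.iterate_succ_apply', ih, map_zero]

end Stage

/-! ### The two shifts on the limit and generation by the right shift -/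

open CStarLimit CStarLimit.Limit UniformSpace

namespace Tower
variable {q : C} (hq : IsStarProjection q)

/-- The inclusion `C = B₀ ⊆ B`. -/
def incl : C →⋆ₐ[ℂ] Limit (Stage.bond D hq) := (of _).comp (Stage.zeroHom D hq)

/-- The endomorphism of `B` induced by the left shifts. -/
def left : Limit (Stage.bond D hq) →⋆ₙₐ[ℂ] Limit (Stage.bond D hq) :=
  Limit.map (Stage.shift D hq) (Stage.shift_bond D hq)

/-- The endomorphism of `B` induced by the right shifts. -/
def right : Limit (Stage.bond D hq) →ₙₐ[ℂ] Limit (Stage.bond D hq) :=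
  delayMap (Stage.delay D hq) (Stage.delay_bond D hq)

theorem continuous_left : Continuous (left D hq) := Completion.continuous_map

theorem continuous_right : Continuous (right D hq) := Completion.continuous_map

theorem left_coe (a : Pre (Stage.bond D hq)) :
    left D hq a = (preMap (Stage.shift D hq) (Stage.shift_bond D hq) a : Limit (Stage.bond D hq)) :=
  map_coe _ _ a

theorem right_coe (a : Pre (Stage.bond D hq)) :
    right D hq a = (preDelay (Stage.delay D hq) (Stage.delay_bond D hq) a : Limit (Stage.bond D hq)) :=
  delayMap_coe _ _ a

theorem incl_apply (c : C) :
    incl D hq c = (preOf (Stage.bond D hq) (Stage.zeroHom D hq c) : Limit (Stage.bond D hq)) := rfl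

theorem incl_injective (hker : ∀ x, D x = 0 → q * x = x) : Function.Injective (incl D hq) :=
  (of_injective (Stage.bond_injective D hq hker)).comp fun _ _ h =>
    congrFun (congrArg Subtype.val h) 0

theorem coe_one : (1 : Limit (Stage.bond D hq)) = ((1 : Pre (Stage.bond D hq)) : Limit (Stage.bond D hq)) := rfl

theorem left_right (b : Limit (Stage.bond D hq)) :
    left D hq (right D hq b) = left D hq 1 * b := by
  have h1 := continuous_left D hq
  have h2 := continuous_right D hq
  induction b using Completion.induction_on with
  | hp => exact isClosed_eq (by fun_prop) (by fun_prop)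
  | ih a =>
    rw [right_coe, left_coe, coe_one, left_coe, ← Completion.coe_mul]
    rfl

/-- On threads this is `Stage.delay_shift` from index 1 on. At index 0 the delayed thread is 0 by
convention, which the limit does not see. -/
theorem right_left (b : Limit (Stage.bond D hq)) :
    right D hq (left D hq b) = right D hq 1 * b := by
  have h1 := continuous_left D hq
  have h2 := continuous_right D hq
  induction b using Completion.induction_on with
  | hp => exact isClosed_eq (by fun_prop) (by fun_prop)
  | ih a =>
    rw [left_coe, right_coe, coe_one, right_coe, ← Completion.coe_mul]
    refine coe_eq_of_eventually_eq (eventually_atTop.2 ⟨1, fun n hn => ?_⟩)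
    obtain ⟨n, rfl⟩ : ∃ m, n = m + 1 := ⟨n - 1, by omega⟩
    exact Stage.delay_shift D hq n _

theorem threadFrom_zeroHom_unit (hDq : D q = 0) (n : ℕ) :
    (threadFrom (Stage.bond D hq) (Stage.zeroHom D hq q) (n + 1)).1 = Fin.cons q 0 := by
  funext k
  rw [Stage.threadFrom_zeroHom_apply]
  refine Fin.cases ?_ (fun k => ?_) k
  · simp [hq.isIdempotentElem.eq]
  · rw [Fin.val_succ, Stage.iterate_apply_unit D hDq, mul_zero, ite_self]
    rfl

theorem right_one (hDq : D q = 0) : right D hq 1 = 1 - incl D hq q := by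
  rw [coe_one, right_coe, incl_apply, ← Completion.coe_sub]
  refine coe_eq_of_eventually_eq (eventually_atTop.2 ⟨1, fun n hn => ?_⟩)
  obtain ⟨n, rfl⟩ : ∃ m, n = m + 1 := ⟨n - 1, by omega⟩
  refine Subtype.ext <| funext fun k => ?_
  change (Stage.delay D hq n 1).1 k = stageUnit D q (n + 1) k -
    (threadFrom (Stage.bond D hq) (Stage.zeroHom D hq q) (n + 1)).1 k
  rw [threadFrom_zeroHom_unit D hq hDq]
  refine Fin.cases ?_ (fun k => ?_) k
  · rw [Stage.delay_apply_zero]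
    simp [stageUnit]
  · rw [Stage.delay_one_apply_succ, Fin.cons_succ, Pi.zero_apply, sub_zero]

/-- From stage 1 on, `q` is supported in place 0, and the connecting maps no longer change that
place once the stage is at least 1. This is why the thread relation is assumed from `n + 1` and not
from `n`. -/
theorem unit_mul_coe (hDq : D q = 0) {n : ℕ} {a : Pre (Stage.bond D hq)}
    (ha : ∀ m, n + 1 ≤ m → Stage.bond D hq m (a.1 m) = a.1 (m + 1)) :
    incl D hq q * a = incl D hq q * incl D hq ((a.1 (n + 1)).1 0) := by
  rw [incl_apply, incl_apply, ← Completion.coe_mul, ← Completion.coe_mul]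
  refine coe_eq_of_eventually_eq (eventually_atTop.2 ⟨n + 1, fun m hm => ?_⟩)
  have h0 : (a.1 m).1 0 = (a.1 (n + 1)).1 0 := by
    induction m, hm using Nat.le_induction with
    | base => rfl
    | succ m hm ih =>
      rw [← ih, ← ha m hm]
      change Stage.bondFun D q m (a.1 m).1 0 = (a.1 m).1 0
      rw [Stage.bondFun, dif_pos (by simp), if_pos (by simp; omega)]
      rfl
  obtain ⟨m, rfl⟩ : ∃ k, m = k + 1 := ⟨m - 1, by omega⟩
  refine Subtype.ext <| funext fun k => ?_
  change (threadFrom (Stage.bond D hq) (Stage.zeroHom D hq q) (m + 1)).1 k * (a.1 (m + 1)).1 k =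
    (threadFrom (Stage.bond D hq) (Stage.zeroHom D hq q) (m + 1)).1 k *
      (threadFrom (Stage.bond D hq) (Stage.zeroHom D hq ((a.1 (n + 1)).1 0)) (m + 1)).1 k
  rw [threadFrom_zeroHom_unit D hq hDq, Stage.threadFrom_zeroHom_apply, ← h0]
  refine Fin.cases ?_ (fun k => ?_) k
  · simp [← mul_assoc, hq.isIdempotentElem.eq]
  · simp

/-- The algebra `B` is generated by `C` and the right shift. -/
theorem induction_on (hDq : D q = 0) {p : Limit (Stage.bond D hq) → Prop}
    (hcl : IsClosed {b | p b}) (hincl : ∀ c, p (incl D hq c))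
    (hadd : ∀ a b, p a → p b → p (a + b)) (hmul : ∀ a b, p a → p b → p (a * b))
    (hright : ∀ b, p b → p (right D hq b)) (b : Limit (Stage.bond D hq)) : p b := by
  -- Induction on the stage from which `a` is a genuine thread; such elements are dense in the
  -- limit.
  have key : ∀ (n : ℕ) (a : Pre (Stage.bond D hq)),
      (∀ m, n ≤ m → Stage.bond D hq m (a.1 m) = a.1 (m + 1)) → p a := fun n => by
    induction n with
    | zero =>
      intro a ha
      have h : (a : Limit (Stage.bond D hq)) = incl D hq ((a.1 0).1 0) := by
        refine congrArg _ (Subtype.ext <| funext fun n => ?_)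
        induction n with
        | zero => exact Subtype.ext <| funext fun k => by rw [Fin.fin_one_eq_zero k]; rfl
        | succ n ih => exact (ha n n.zero_le).symm.trans (congrArg _ ih)
      rw [h]
      exact hincl _
    | succ n ih =>
      intro a ha
      -- Since `right 1 = 1 - q`, the second summand is `(1 - q) * a`. Its argument `left a` is a
      -- thread already from stage `n`.
      have h : (a : Limit (Stage.bond D hq)) = incl D hq q * a + right D hq (left D hq a) := by
        rw [right_left, right_one D hq hDq]
        ring
      rw [h, unit_mul_coe D hq hDq ha]
      refine hadd _ _ (hmul _ _ (hincl _) (hincl _)) (hright _ ?_)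
      rw [left_coe]
      refine ih _ fun m hm => ?_
      change Stage.bond D hq m (Stage.shift D hq m (a.1 (m + 1))) =
        Stage.shift D hq (m + 1) (a.1 (m + 1 + 1))
      rw [← ha (m + 1) (by omega), Stage.shift_bond]
  refine Completion.induction_on b hcl fun a => ?_
  obtain ⟨n, hn⟩ := eventually_atTop.1 a.2
  exact key n a hn

end Tower
end Tower
end NatExt

namespace NatExt
open WeakDual

/-! ### Points of `X ∪ {0}` as characters or zero, and dual maps of spectra -/

section Eval
variable {X : Type v} [TopologicalSpace X] {A : Type u} [CommCStarAlgebra A]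
  (e : X ≃ₜ characterSpace ℂ A)

/-- The value of `a` at a point of `X ∪ {0}`, with `a(0) = 0`. -/
def eval (p : X ⊕ Unit) (a : A) : ℂ := Sum.elim (fun y : X => e y a) (fun _ => 0) p

theorem eval_inl (y : X) (a : A) : eval e (Sum.inl y) a = e y a := rfl

theorem eval_inr (a : A) : eval e (Sum.inr ()) a = 0 := rfl

theorem eval_one_ne_zero_iff {p : X ⊕ Unit} : eval e p 1 ≠ 0 ↔ ∃ y, p = Sum.inl y := by
  obtain y | ⟨⟩ := p
  · simp [eval_inl]
  · exact iff_of_false (fun h => h rfl) (by simp)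

/-- The value at the unit of `A` separates the abstract point from `X`, and characters separate the
points of `X`. -/
theorem eval_injective : Function.Injective (eval e) := by
  have key : ∀ (y : X), eval e (Sum.inl y) ≠ eval e (Sum.inr ()) := fun y h =>
    (eval_one_ne_zero_iff e).2 ⟨y, rfl⟩ (congrFun h 1)
  rintro (y | ⟨⟩) (z | ⟨⟩) h
  · exact congrArg _ (e.injective (DFunLike.ext _ _ fun a => congrFun h a))
  · exact absurd h (key y)
  · exact absurd h.symm (key z)
  · rfl

theorem continuous_eval : Continuous (eval e) := by
  refine continuous_pi fun a => continuous_sum_dom.2 ⟨?_, continuous_const⟩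
  exact (WeakDual.eval_continuous a).comp (continuous_subtype_val.comp e.continuous)

theorem isClosedEmbedding_eval [CompactSpace X] : IsClosedEmbedding (eval e) :=
  (continuous_eval e).isClosedEmbedding (eval_injective e)

/-- Urysohn's lemma in `A = C(X)`. -/
theorem exists_eval_eq_one_and_zero [CompactSpace X] [T2Space X] {F : Set X} (hF : IsClosed F)
    {x : X} (hx : x ∉ F) : ∃ a : A, e x a = 1 ∧ ∀ y ∈ F, e y a = 0 := by
  obtain ⟨f, h0, h1, -⟩ := exists_continuous_zero_one_of_isClosed hF (isClosed_singleton (x := x))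
    (Set.disjoint_singleton_right.2 hx)
  let g : C(characterSpace ℂ A, ℂ) := ⟨fun χ => (f (e.symm χ) : ℂ), by fun_prop⟩
  have hg : ∀ y, e y ((gelfandStarTransform A).symm g) = f y := fun y => by
    have := DFunLike.congr_fun ((gelfandStarTransform A).apply_symm_apply g) (e y)
    refine Eq.trans ?_ (this.trans ?_)
    · rfl
    · simp [g]
  refine ⟨(gelfandStarTransform A).symm g, ?_, fun y hy => ?_⟩
  · rw [hg, h1 rfl]; simp
  · rw [hg, h0 hy]; simp

theorem eq_zero_of_forall_eval_eq_zero {a : A} (h : ∀ x, e x a = 0) : a = 0 := by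
  apply (gelfandStarTransform A).injective
  rw [map_zero]
  ext χ
  rw [← e.apply_symm_apply χ]
  exact h _

variable {B : Type u} [CommCStarAlgebra B]

/-- `φ 1` is idempotent, so `χ (φ 1)` is 1 or 0. Accordingly `χ ∘ φ` is a character or vanishes
identically. -/
theorem exists_eval_eq (φ : A →ₙₐ[ℂ] B) (χ : characterSpace ℂ B) :
    ∃ p : X ⊕ Unit, ∀ a, eval e p a = χ (φ a) := by
  by_cases h : χ (φ 1) = 1
  · let g : A →ₐ[ℂ] ℂ := AlgHom.ofLinearMap
      { toFun := fun a => χ (φ a)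
        map_add' := fun a b => by rw [map_add, map_add]
        map_smul' := fun c a => by rw [map_smul, map_smul]; rfl } h
      fun a b => by
        change χ (φ (a * b)) = χ (φ a) * χ (φ b)
        rw [map_mul, map_mul]
    refine ⟨Sum.inl (e.symm (CharacterSpace.equivAlgHom.symm g)), fun a => ?_⟩
    rw [eval_inl, e.apply_symm_apply]
    rfl
  · have h2 : χ (φ 1) = 0 := by
      have h3 : χ (φ 1) * χ (φ 1) = χ (φ 1) := by rw [← map_mul, ← map_mul, one_mul]
      by_contra h0
      exact h (mul_left_cancel₀ h0 (by rw [h3, mul_one]))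
    refine ⟨Sum.inr (), fun a => ?_⟩
    rw [eval_inr, ← one_mul a, map_mul, map_mul, h2, zero_mul]

/-- The map of spectra (with an added point) dual to a homomorphism. -/
def pullback (φ : A →ₙₐ[ℂ] B) (χ : characterSpace ℂ B) : X ⊕ Unit :=
  (exists_eval_eq e φ χ).choose

theorem eval_pullback (φ : A →ₙₐ[ℂ] B) (χ : characterSpace ℂ B) (a : A) :
    eval e (pullback e φ χ) a = χ (φ a) := (exists_eval_eq e φ χ).choose_spec a

theorem continuous_pullback [CompactSpace X] (φ : A →ₙₐ[ℂ] B) : Continuous (pullback e φ) := by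
  refine (isClosedEmbedding_eval e).continuous_iff.2 (continuous_pi fun a => ?_)
  exact ((WeakDual.eval_continuous (φ a)).comp continuous_subtype_val).congr fun χ =>
    (eval_pullback e φ χ a).symm

theorem pullback_eq_iff (φ : A →ₙₐ[ℂ] B) (χ : characterSpace ℂ B) (p : X ⊕ Unit) :
    pullback e φ χ = p ↔ ∀ a, χ (φ a) = eval e p a := by
  rw [← (eval_injective e).eq_iff, funext_iff]
  simp only [eval_pullback]

/-- A character that vanishes on the kernel of a homomorphism lifts along it. -/
theorem exists_pullback_eq [CompactSpace X] [T2Space X] (φ : A →ₙₐ[ℂ] B) (y : X)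
    (hy : ∀ a, φ a = 0 → e y a = 0) : ∃ χ, pullback e φ χ = Sum.inl y := by
  by_contra! h
  have hK : IsClosed (Sum.inl ⁻¹' Set.range (pullback e φ) : Set X) :=
    (isCompact_range (continuous_pullback e φ)).isClosed.preimage continuous_inl
  -- The image of the dual map is compact. If it misses `y`, this `a` vanishes on it, so every
  -- character kills `φ a`; then `φ a = 0` although `a(y) = 1`.
  obtain ⟨a, h1, h0⟩ := exists_eval_eq_one_and_zero e hK (x := y) fun ⟨χ, hχ⟩ => h χ hχ
  have hφ : φ a = 0 := eq_zero_of_forall_eval_eq_zero (Homeomorph.refl _) fun χ => by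
    change χ (φ a) = 0
    rw [← eval_pullback e]
    rcases hp : pullback e φ χ with z | ⟨⟩
    · exact h0 z ⟨χ, hp⟩
    · rfl
  simp [hy a hφ] at h1

end Eval

/-! ### The space of sequences and its shift -/

namespace PartialSystem
section Dynamics
variable {X : Type v} [TopologicalSpace X] (S : PartialSystem X)

theorem left_mem_iterDom_of_isStep {n : ℕ} {p p' : X ⊕ Unit} (h : S.IsStep p p')
    (hp : ∃ y ∈ S.iterDom n, p' = Sum.inl y) : ∃ y ∈ S.iterDom (n + 1), p = Sum.inl y := by
  obtain ⟨z, hz, rfl, rfl⟩ := h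
  obtain ⟨y, hy, h⟩ := hp
  cases h
  exact ⟨z, ⟨hz, hy⟩, rfl⟩

theorem mem_iterDom_of_isStep {x : ℕ → X ⊕ Unit} (h0 : ∃ y, x 0 = Sum.inl y) (n : ℕ)
    (hs : ∀ k < n, S.IsStep (x (k + 1)) (x k)) : ∃ y ∈ S.iterDom n, x n = Sum.inl y := by
  induction n with
  | zero =>
    obtain ⟨y, hy⟩ := h0
    exact ⟨y, trivial, hy⟩
  | succ n ih =>
    exact S.left_mem_iterDom_of_isStep (hs n n.lt_succ_self) (ih fun k hk => hs k (by omega))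

/-- A criterion without the index `N`. The conditions `xₙ ∈ Δₙ` follow from the steps, starting at
`x₀`; a step never ends in 0, so all terms after the first 0 are 0. -/
theorem mem_extSpace {x : ℕ → X ⊕ Unit} (h0 : x 0 ≠ Sum.inr ())
    (hstep : ∀ n, x (n + 1) ≠ Sum.inr () → S.IsStep (x (n + 1)) (x n))
    (hend : ∀ n, x n ≠ Sum.inr () → x (n + 1) = Sum.inr () →
      ∃ y ∈ closure S.imageᶜ, x n = Sum.inl y) : x ∈ S.extSpace := by
  classical
  have hne : ∀ n, x n ≠ Sum.inr () → ∃ y, x n = Sum.inl y := fun n h => by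
    rcases hx : x n with y | ⟨⟩
    · exact ⟨y, rfl⟩
    · exact absurd hx h
  by_cases hall : ∀ n, x n ≠ Sum.inr ()
  · exact Or.inr ⟨fun n => S.mem_iterDom_of_isStep (hne 0 h0) n fun k _ => hstep k (hall _),
      fun n => hstep n (hall _)⟩
  · push Not at hall
    -- The first index with value 0 is positive, and its predecessor is the `N` with `x ∈ X_N`.
    have hpos : Nat.find hall ≠ 0 := fun h => h0 (h ▸ Nat.find_spec hall)
    obtain ⟨N, hN⟩ := Nat.exists_eq_succ_of_ne_zero hpos
    have hlt : ∀ n ≤ N, x n ≠ Sum.inr () := fun n hn => Nat.find_min hall (by omega)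
    have hge : ∀ n, N < n → x n = Sum.inr () := fun n hn => by
      induction n, hn using Nat.le_induction with
      | base => exact hN ▸ Nat.find_spec hall
      | succ n hn ih =>
        by_contra h
        obtain ⟨y, hy, -, h2⟩ := hstep n h
        simp [h2] at ih
    refine Or.inl (Set.mem_iUnion.2 ⟨N, fun n hn => ?_, fun n hn => ?_, ?_, hge⟩)
    · exact S.mem_iterDom_of_isStep (hne 0 h0) n fun k hk => hstep k (hlt _ (by omega))
    · exact hstep n (hlt _ (by omega))
    · exact hend N (hlt N le_rfl) (hge _ N.lt_succ_self)

theorem extSpace_isStep {x : ℕ → X ⊕ Unit} (hx : x ∈ S.extSpace) {n : ℕ} {y : X}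
    (h : x (n + 1) = Sum.inl y) : S.IsStep (x (n + 1)) (x n) := by
  rcases hx with hx | ⟨_, hx⟩
  · obtain ⟨N, -, h2, -, h4⟩ := Set.mem_iUnion.1 hx
    by_cases hn : n < N
    · exact h2 n hn
    · simp [h4 (n + 1) (by omega)] at h
  · exact hx n

theorem tail_mem {x : ℕ → X ⊕ Unit} (hx : x ∈ S.extSpace) {y : X} (h : x 1 = Sum.inl y) :
    (fun n => x (n + 1)) ∈ S.extSpace := by
  refine S.mem_extSpace (by simp [h]) (fun n hn => ?_) (fun n hn hn1 => ?_)
  · rcases hz : x (n + 1 + 1) with z | ⟨⟩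
    · exact hz ▸ S.extSpace_isStep hx hz
    · exact absurd hz hn
  · rcases hx with hx | ⟨h1, _⟩
    · obtain ⟨N, h1, -, h3, h4⟩ := Set.mem_iUnion.1 hx
      have hN : n + 1 = N := by
        by_contra hne
        rcases Nat.lt_or_gt_of_ne hne with hlt | hlt
        · obtain ⟨z, _, hz⟩ := h1 (n + 1 + 1) hlt
          simp [hz] at hn1
        · exact hn (h4 _ hlt)
      subst hN
      exact h3
    · obtain ⟨z, _, hz⟩ := h1 (n + 1 + 1)
      simp [hz] at hn1

theorem image_naturalExtension : S.naturalExtension.image = S.extImage := by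
  ext x
  constructor
  · rintro ⟨⟨x, hx⟩, rfl⟩
    exact hx
  · rintro ⟨y, hy, h⟩
    have hd : (⟨_, S.tail_mem x.2 h⟩ : S.extSpace) ∈ S.extDom := ⟨y, hy, h⟩
    refine ⟨⟨_, hd⟩, Subtype.ext <| funext fun n => ?_⟩
    cases n with
    | zero =>
      obtain ⟨z, hz, h1, h0⟩ := S.extSpace_isStep x.2 h
      change S.pointMap (x.1 1) = x.1 0
      rw [h1, h0]
      exact S.pointMap_inl z hz
    | succ n => rfl

theorem isOpen_extImage : IsOpen S.extImage := by
  have h : IsOpen (Sum.inl '' S.dom : Set (X ⊕ Unit)) :=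
    IsOpenEmbedding.inl.isOpenMap _ S.isClopen_dom.isOpen
  have hc : Continuous fun x : S.extSpace => x.1 1 :=
    (continuous_apply 1).comp continuous_subtype_val
  convert h.preimage hc using 1
  ext x
  simp [extImage, eq_comm]

theorem isOpenEmbedding_naturalExtension : IsOpenEmbedding S.naturalExtension.map := by
  refine ⟨?_, ?_⟩
  · have hg : Continuous fun (x : S.extSpace) (n : ℕ) => x.1 (n + 1) :=
      continuous_pi fun n => (continuous_apply (n + 1)).comp continuous_subtype_val
    -- Dropping the first entry undoes the shift continuously: the composite is the plain inclusion
    -- of `extDom` into sequences.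
    refine IsEmbedding.of_comp S.naturalExtension.continuous_map hg ?_
    exact IsEmbedding.subtypeVal.comp IsEmbedding.subtypeVal
  · change IsOpen S.naturalExtension.image
    rw [image_naturalExtension]
    exact S.isOpen_extImage

end Dynamics
end PartialSystem
end NatExt

namespace NatExt
open WeakDual

/-! ### Translation between the dynamics on `X` and the algebra `A` -/

section Generated
variable {X : Type v} [TopologicalSpace X]
  {A : Type u} [CommCStarAlgebra A] {δ : A →⋆ₙₐ[ℂ] A} {S : PartialSystem X}
  {e : X ≃ₜ characterSpace ℂ A}

namespace PartialSystem

/-- This turns `α(xₙ₊₁) = xₙ` into an identity of functionals. The condition on `p'` is needed: for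
`p' = 0` the identity also holds when `p` is 0 or lies off `Δ₁`. -/
theorem GeneratedBy.isStep_iff (hS : S.GeneratedBy δ e) {p p' : X ⊕ Unit} :
    S.IsStep p p' ↔ (∃ y, p' = Sum.inl y) ∧ ∀ a, eval e p (δ a) = eval e p' a := by
  constructor
  · rintro ⟨x, hx, rfl, rfl⟩
    exact ⟨⟨_, rfl⟩, fun a => (hS x a).1 hx⟩
  · rintro ⟨⟨y, rfl⟩, h⟩
    have h1 : eval e p (δ 1) = 1 := (h 1).trans (map_one (e y))
    obtain x | ⟨⟩ := p
    · have hx : x ∈ S.dom := by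
        by_contra hx
        rw [eval_inl, (hS x 1).2 hx] at h1
        exact zero_ne_one h1
      refine ⟨x, hx, rfl, eval_injective e (funext fun a => ?_)⟩
      rw [← h, eval_inl, eval_inl, (hS x a).1 hx]
    · exact absurd h1 zero_ne_one

theorem GeneratedBy.eval_iterate_one (hS : S.GeneratedBy δ e) {n : ℕ} {x : X}
    (hx : x ∈ S.iterDom n) : e x (δ^[n] 1) = 1 := by
  induction n generalizing x with
  | zero => exact map_one (e x)
  | succ n ih =>
    obtain ⟨hd, hx⟩ := hx
    rw [Function.iterate_succ_apply', (hS x _).1 hd, ih hx]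

theorem GeneratedBy.apply_eq_zero (hS : S.GeneratedBy δ e) {a : A}
    (h : ∀ y ∈ S.image, e y a = 0) : δ a = 0 := by
  refine eq_zero_of_forall_eval_eq_zero e fun x => ?_
  by_cases hx : x ∈ S.dom
  · rw [(hS x a).1 hx]
    exact h _ ⟨_, rfl⟩
  · exact (hS x a).2 hx

/-- The ideal `I^⊥` consists of the functions that vanish on the closure of `X ∖ Δ₋₁`. -/
theorem GeneratedBy.mem_orthogonal_iff [CompactSpace X] [T2Space X]
    (hS : S.GeneratedBy δ e) (a : A) :
    a ∈ (kernelIdeal δ).orthogonal.ideal ↔ ∀ y ∈ closure S.imageᶜ, e y a = 0 := by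
  constructor
  · intro ha y hy
    have hcl : IsClosed {y | e y a = 0} := isClosed_eq
      ((WeakDual.eval_continuous a).comp (continuous_subtype_val.comp e.continuous))
      continuous_const
    refine closure_minimal (fun z hz => ?_) hcl hy
    have : CompactSpace S.dom := isCompact_iff_compactSpace.1 S.isClopen_dom.isClosed.isCompact
    have him : IsClosed S.image := (isCompact_range S.continuous_map).isClosed
    -- `Δ₋₁` is compact, hence closed, so some `b ∈ ker δ` has value 1 at `z`; then `a * b = 0`
    -- gives `a(z) = 0`.
    obtain ⟨b, h1, h0⟩ := exists_eval_eq_one_and_zero e him hz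
    have hab : a * b = 0 := ha b (hS.apply_eq_zero h0)
    change e z a = 0
    rw [← mul_one (e z a), ← h1, ← map_mul, hab, map_zero]
  · intro h b (hb : δ b = 0)
    refine eq_zero_of_forall_eval_eq_zero e fun x => ?_
    rw [map_mul]
    by_cases hx : x ∈ S.image
    · obtain ⟨y, rfl⟩ := hx
      rw [← (hS y b).1 y.2, hb, map_zero, mul_zero]
    · rw [h x (subset_closure hx), zero_mul]

end PartialSystem

/-- A C*-algebra `B` that is generated by `A` and a transfer operator `t` of an endomorphism `d`
that extends `δ`, such that the unit of `ker d` annihilates precisely `(ker δ)^⊥` in `A`. -/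
structure IsTransferExtension {B : Type u} [CommCStarAlgebra B] (δ : A →⋆ₙₐ[ℂ] A) (ι : A →⋆ₐ[ℂ] B)
    (d : B →⋆ₙₐ[ℂ] B) (t : B →ₙₐ[ℂ] B) : Prop where
  injective : Function.Injective ι
  apply_embed : ∀ a, d (ι a) = ι (δ a)
  apply_transfer : ∀ b, d (t b) = d 1 * b
  transfer_apply : ∀ b, t (d b) = t 1 * b
  mem_orthogonal_iff : ∀ a, (1 - t 1) * ι a = 0 ↔ a ∈ (kernelIdeal δ).orthogonal.ideal
  ext : ∀ χ χ' : characterSpace ℂ B,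
    (∀ (n : ℕ) (a : A), χ (t^[n] (ι a)) = χ' (t^[n] (ι a))) → χ = χ'

/-! ### The spectrum of an extension with a transfer operator -/

namespace IsTransferExtension
variable {B : Type u} [CommCStarAlgebra B] {ι : A →⋆ₐ[ℂ] B}
    {d : B →⋆ₙₐ[ℂ] B} {t : B →ₙₐ[ℂ] B}

theorem isCompleteTransferOperator (H : IsTransferExtension δ ι d t) :
    IsCompleteTransferOperator d t := by
  refine ⟨1 - t 1, ?_, fun b hb => ?_, fun b => ⟨?_, ?_⟩⟩
  · rw [map_sub, H.apply_transfer, mul_one, sub_self]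
  · have h := H.transfer_apply b
    rw [hb, map_zero] at h
    have h2 : (1 - t 1) * b = b := by rw [sub_mul, ← h, one_mul, sub_zero]
    exact ⟨h2, (mul_comm _ _).trans h2⟩
  · rw [sub_sub_cancel, ← map_mul, one_mul]
  · rw [H.apply_transfer, mul_right_comm, ← map_mul, one_mul]

theorem isIdempotentElem_transfer_one (t : B →ₙₐ[ℂ] B) : IsIdempotentElem (t 1) := by
  rw [IsIdempotentElem, ← map_mul, one_mul]

theorem iterate_apply_transfer (H : IsTransferExtension δ ι d t) (n : ℕ) (b : B) :
    d^[n] (t^[n] b) = d^[n] 1 * b := by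
  induction n generalizing b with
  | zero => exact (one_mul b).symm
  | succ n ih =>
    rw [Function.iterate_succ_apply, Function.iterate_succ_apply' t, H.apply_transfer,
      iterate_map_mul, ih, ← Function.iterate_succ_apply, ← mul_assoc, mul_comm (d^[n + 1] 1),
      iterate_one_mul_succ]

theorem iterate_apply_embed (H : IsTransferExtension δ ι d t) (n : ℕ) :
    d^[n] 1 = ι (δ^[n] 1) := by
  induction n with
  | zero => exact (map_one ι).symm
  | succ n ih => rw [Function.iterate_succ_apply', Function.iterate_succ_apply', ih, H.apply_embed]

/-- The map `a ↦ tⁿ(c a)` for a projection `c`. -/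
def iterHom (ι : A →⋆ₐ[ℂ] B) (t : B →ₙₐ[ℂ] B) (n : ℕ) {c : B} (hc : IsIdempotentElem c) :
    A →ₙₐ[ℂ] B where
  toFun := fun a => t^[n] (c * ι a)
  map_smul' := fun r a => by
    have h : ∀ b : B, t^[n] (r • b) = r • t^[n] b := fun b => by
      induction n with
      | zero => rfl
      | succ n ih => rw [Function.iterate_succ_apply', Function.iterate_succ_apply', ih, map_smul]
    rw [map_smul, mul_smul_comm, h]
    rfl
  map_zero' := by rw [map_zero, mul_zero, iterate_map_zero]
  map_add' := fun a b => by rw [map_add, mul_add, iterate_map_add]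
  map_mul' := fun a b => by
    rw [← iterate_map_mul, mul_mul_mul_comm, hc.eq, map_mul]

theorem iterHom_apply (ι : A →⋆ₐ[ℂ] B) (t : B →ₙₐ[ℂ] B) (n : ℕ) {c : B}
    (hc : IsIdempotentElem c) (a : A) : iterHom ι t n hc a = t^[n] (c * ι a) := rfl

/-- The sequence `(x₀, x₁, …)` in `X ∪ {0}` of a character of `B`. -/
def orbit (e : X ≃ₜ characterSpace ℂ A) (ι : A →⋆ₐ[ℂ] B) (t : B →ₙₐ[ℂ] B)
    (χ : characterSpace ℂ B) (n : ℕ) : X ⊕ Unit :=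
  pullback e (iterHom ι t n IsIdempotentElem.one) χ

theorem eval_orbit (χ : characterSpace ℂ B) (n : ℕ) (a : A) :
    eval e (orbit e ι t χ n) a = χ (t^[n] (ι a)) := by
  rw [orbit, eval_pullback, iterHom_apply, one_mul]

theorem orbit_eq_iff (χ : characterSpace ℂ B) (n : ℕ) (p : X ⊕ Unit) :
    orbit e ι t χ n = p ↔ ∀ a, χ (t^[n] (ι a)) = eval e p a := by
  rw [orbit, pullback_eq_iff]
  simp only [iterHom_apply, one_mul]

theorem continuous_orbit [CompactSpace X] : Continuous (orbit (B := B) e ι t) :=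
  continuous_pi fun _ => continuous_pullback e _

/-- Comes from `t (d b) = t 1 * b`. Where `χ (t^[n + 1] 1) = 1` it says that `α` maps the coordinate
`n + 1` to the coordinate `n`. -/
theorem apply_iterate_succ (H : IsTransferExtension δ ι d t) (χ : characterSpace ℂ B) (n : ℕ)
    (a : A) : χ (t^[n + 1] (ι (δ a))) = χ (t^[n + 1] 1) * χ (t^[n] (ι a)) := by
  rw [Function.iterate_succ_apply, ← H.apply_embed, H.transfer_apply, iterate_map_mul, map_mul,
    ← Function.iterate_succ_apply]

theorem apply_iterate_one (χ : characterSpace ℂ B) (n : ℕ) {p : X ⊕ Unit}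
    (hp : orbit e ι t χ n = p) : χ (t^[n] 1) = eval e p 1 := by
  rw [← hp, eval_orbit, map_one]

theorem apply_iterate_one_eq_one (χ : characterSpace ℂ B) (n : ℕ) {y : X}
    (hy : orbit e ι t χ n = Sum.inl y) : χ (t^[n] 1) = 1 :=
  (apply_iterate_one χ n hy).trans (map_one (e y))

theorem apply_iterate_succ_one_mul (χ : characterSpace ℂ B) (n : ℕ) (b : B) :
    χ (t^[n + 1] b) = χ (t^[n + 1] 1) * χ (t^[n + 1] b) := by
  rw [← map_mul, ← iterate_map_mul, one_mul]

/-- The idempotents `tⁿ(1)` decrease, so an orbit that reaches 0 stays there. -/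
theorem apply_iterate_succ_one (χ : characterSpace ℂ B) (n : ℕ) :
    χ (t^[n + 1] 1) = χ (t^[n + 1] 1) * χ (t^[n] 1) := by
  rw [← map_mul, Function.iterate_succ_apply, ← iterate_map_mul, mul_one]

theorem orbit_mem [CompactSpace X] [T2Space X]
    (H : IsTransferExtension δ ι d t) (hS : S.GeneratedBy δ e)
    (χ : characterSpace ℂ B) : orbit e ι t χ ∈ S.extSpace := by
  have hinl : ∀ n, orbit e ι t χ n ≠ Sum.inr () → ∃ y, orbit e ι t χ n = Sum.inl y :=
    fun n h => by
      rcases hx : orbit e ι t χ n with y | ⟨⟩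
      · exact ⟨y, rfl⟩
      · exact absurd hx h
  refine S.mem_extSpace (fun h => ?_) (fun n hn => ?_) fun n hn hn1 => ?_
  · have := apply_iterate_one χ 0 h
    rw [Function.iterate_zero_apply, map_one, eval_inr] at this
    exact one_ne_zero this
  · obtain ⟨y, hy⟩ := hinl _ hn
    have h1 := apply_iterate_one_eq_one χ (n + 1) hy
    refine hS.isStep_iff.2 ⟨hinl n fun h => ?_, fun a => ?_⟩
    · have h2 := apply_iterate_succ_one (t := t) χ n
      rw [h1, one_mul, apply_iterate_one χ n h, eval_inr] at h2
      exact one_ne_zero h2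
    · rw [eval_orbit, eval_orbit, H.apply_iterate_succ, h1, one_mul]
  · obtain ⟨y, hy⟩ := hinl n hn
    refine ⟨y, ?_, hy⟩
    by_contra hcl
    -- This `a` lies in `I^⊥`, so `a = t 1 * a` in `B`. Hence `a(y)` contains the factor `χ (t^[n +
    -- 1] 1)`, which is 0 because the next term is 0.
    obtain ⟨a, h1, h0⟩ := exists_eval_eq_one_and_zero e isClosed_closure hcl
    have ha := (H.mem_orthogonal_iff a).2 ((hS.mem_orthogonal_iff a).2 h0)
    have ha2 : ι a = t 1 * ι a := by
      rw [sub_mul, one_mul, sub_eq_zero] at ha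
      exact ha
    have h2 := eval_orbit (e := e) (ι := ι) (t := t) χ n a
    rw [hy, eval_inl, h1, ha2, iterate_map_mul, map_mul, ← Function.iterate_succ_apply,
      apply_iterate_one χ (n + 1) hn1, eval_inr, zero_mul] at h2
    exact one_ne_zero h2

/-- Each nonzero term determines its predecessor, so agreement of two sequences at one index spreads
downwards. -/
theorem orbit_of_orbit_succ (H : IsTransferExtension δ ι d t) (hS : S.GeneratedBy δ e)
    {x : ℕ → X ⊕ Unit} {χ : characterSpace ℂ B} {n : ℕ} (hstep : S.IsStep (x (n + 1)) (x n))
    (h : orbit e ι t χ (n + 1) = x (n + 1)) : orbit e ι t χ n = x n := by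
  rw [orbit_eq_iff]
  intro a
  obtain ⟨y, hy⟩ : ∃ y, x (n + 1) = Sum.inl y := by
    obtain ⟨y, _, hy, _⟩ := hstep
    exact ⟨y, hy⟩
  rw [← (hS.isStep_iff.1 hstep).2, ← h, eval_orbit, H.apply_iterate_succ,
    apply_iterate_one_eq_one χ (n + 1) (h.trans hy), one_mul]

theorem mul_eq_zero_of_iterate (H : IsTransferExtension δ ι d t) {n : ℕ} {b : B}
    (h : t^[n] b = 0) : b * ι (δ^[n] 1) = 0 := by
  rw [← H.iterate_apply_embed, mul_comm, ← H.iterate_apply_transfer, h, iterate_map_zero]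

theorem exists_orbit_eq_of_infinite [CompactSpace X] [T2Space X]
    (H : IsTransferExtension δ ι d t) (hS : S.GeneratedBy δ e)
    {x : ℕ → X ⊕ Unit} (hx : x ∈ S.infiniteAntiOrbits) :
    ∃ χ : characterSpace ℂ B, orbit e ι t χ = x := by
  obtain ⟨hdom, hstep⟩ := hx
  have hcl : ∀ n, IsClosed {χ : characterSpace ℂ B | orbit e ι t χ n = x n} := fun n =>
    isClosed_eq ((continuous_apply n).comp continuous_orbit) continuous_const
  -- The characters whose orbit agrees with `x` at index `n` form a decreasing sequence of nonempty
  -- compact sets; a common element agrees with `x` everywhere.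
  obtain ⟨χ, hχ⟩ := IsCompact.nonempty_iInter_of_sequence_nonempty_isCompact_isClosed
    (fun n => {χ : characterSpace ℂ B | orbit e ι t χ n = x n})
    (fun n χ h => H.orbit_of_orbit_succ hS (hstep n) h)
    (fun n => by
      obtain ⟨y, hy, hxy⟩ := hdom n
      obtain ⟨χ, hχ⟩ := exists_pullback_eq e (iterHom ι t n IsIdempotentElem.one) y fun a ha => by
        rw [iterHom_apply, one_mul] at ha
        have h := H.mul_eq_zero_of_iterate ha
        rw [← map_mul, ← map_zero ι, H.injective.eq_iff] at h
        have := congrArg (e y) h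
        rwa [map_mul, hS.eval_iterate_one hy, mul_one, map_zero] at this
      exact ⟨χ, hχ.trans hxy.symm⟩)
    (hcl 0).isCompact hcl
  exact ⟨χ, funext fun n => Set.mem_iInter.1 hχ n⟩

theorem exists_orbit_eq_of_finite [CompactSpace X] [T2Space X]
    (H : IsTransferExtension δ ι d t) (hS : S.GeneratedBy δ e)
    {x : ℕ → X ⊕ Unit} {N : ℕ} (hx : x ∈ S.finiteAntiOrbits N) :
    ∃ χ : characterSpace ℂ B, orbit e ι t χ = x := by
  obtain ⟨hdom, hstep, ⟨y, hy, hxy⟩, hend⟩ := hx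
  have hyN : y ∈ S.iterDom N := by
    obtain ⟨z, hz, hxz⟩ := hdom N le_rfl
    cases hxy.symm.trans hxz
    exact hz
  have hq := (isIdempotentElem_transfer_one t).one_sub
  -- The factor `q = 1 - t 1` forces the orbit to stop at `N`. The lift exists because `t^N(q a) =
  -- 0` puts `a * δ^N(1)` in `I^⊥`, which vanishes at `y`, while `δ^N(1)(y) = 1`.
  obtain ⟨χ, hχ⟩ := exists_pullback_eq e (iterHom ι t N hq) y fun a ha => by
    rw [iterHom_apply] at ha
    have h := H.mul_eq_zero_of_iterate ha
    rw [mul_assoc, ← map_mul, H.mem_orthogonal_iff] at h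
    have := (hS.mem_orthogonal_iff _).1 h y hy
    rwa [map_mul, hS.eval_iterate_one hyN, mul_one] at this
  rw [pullback_eq_iff] at hχ
  have h1 : χ (t^[N] (1 - t 1)) = 1 := by
    have := hχ 1
    rw [iterHom_apply, map_one ι, mul_one] at this
    exact this.trans (map_one (e y))
  have hN : orbit e ι t χ N = x N := by
    rw [orbit_eq_iff, hxy]
    intro a
    rw [← hχ, iterHom_apply, iterate_map_mul, map_mul, h1, one_mul]
  -- At `N + 1` the value is that of `t^N(t 1 * q)`, because `χ` is 1 on `t^N(q)`; and `t 1 * q =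
  -- 0`.
  have hgt : ∀ n, N < n → χ (t^[n] 1) = 0 := fun n hn => by
    induction n, hn using Nat.le_induction with
    | base =>
      rw [← mul_one (χ _), ← h1, ← map_mul, Nat.succ_eq_add_one, Function.iterate_succ_apply,
        ← iterate_map_mul, mul_sub, mul_one, (isIdempotentElem_transfer_one t).eq, sub_self,
        iterate_map_zero, map_zero]
    | succ n hn ih => rw [apply_iterate_succ_one, ih, mul_zero]
  have hle : ∀ k ≤ N, orbit e ι t χ (N - k) = x (N - k) := fun k hk => by
    induction k with
    | zero => exact hN
    | succ k ih =>
      have hk' : N - k = N - (k + 1) + 1 := by omega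
      exact H.orbit_of_orbit_succ hS (hstep _ (by omega)) (hk' ▸ ih (by omega))
  refine ⟨χ, funext fun n => ?_⟩
  rcases le_or_gt n N with hn | hn
  · have := hle (N - n) (by omega)
    rwa [Nat.sub_sub_self hn] at this
  · rw [hend n hn, orbit_eq_iff]
    intro a
    obtain ⟨n, rfl⟩ := Nat.exists_eq_succ_of_ne_zero (show n ≠ 0 by omega)
    rw [Nat.succ_eq_add_one, apply_iterate_succ_one_mul, hgt (n + 1) hn, zero_mul, eval_inr]

/-- The identification of the spectrum of `B` with the space of sequences. -/
def spectrumHomeomorph [CompactSpace X] [T2Space X]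
    (H : IsTransferExtension δ ι d t) (hS : S.GeneratedBy δ e) :
    characterSpace ℂ B ≃ₜ S.extSpace :=
  Continuous.homeoOfEquivCompactToT2
    (f := Equiv.ofBijective (fun χ => (⟨orbit e ι t χ, H.orbit_mem hS χ⟩ : S.extSpace)) ⟨by
      intro χ χ' h
      refine H.ext χ χ' fun n a => ?_
      rw [← eval_orbit (e := e), ← eval_orbit (e := e), show orbit e ι t χ = orbit e ι t χ' from congrArg Subtype.val h], by
      rintro ⟨x, hx⟩
      have : ∃ χ : characterSpace ℂ B, orbit e ι t χ = x := by
        rcases hx with hx | hx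
        · obtain ⟨N, hN⟩ := Set.mem_iUnion.1 hx
          exact H.exists_orbit_eq_of_finite hS hN
        · exact H.exists_orbit_eq_of_infinite hS hx
      obtain ⟨χ, hχ⟩ := this
      exact ⟨χ, Subtype.ext hχ⟩⟩)
    (continuous_orbit.subtype_mk _)

theorem orbit_spectrumHomeomorph_symm [CompactSpace X] [T2Space X]
    (H : IsTransferExtension δ ι d t) (hS : S.GeneratedBy δ e)
    (x : S.extSpace) : orbit e ι t ((H.spectrumHomeomorph hS).symm x) = x.1 :=
  congrArg Subtype.val ((H.spectrumHomeomorph hS).apply_symm_apply x)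

theorem spectrumHomeomorph_symm_apply [CompactSpace X] [T2Space X]
    (H : IsTransferExtension δ ι d t) (hS : S.GeneratedBy δ e)
    (x : S.extSpace) (n : ℕ) (a : A) :
    (H.spectrumHomeomorph hS).symm x (t^[n] (ι a)) = eval e (x.1 n) a := by
  rw [← eval_orbit (e := e), orbit_spectrumHomeomorph_symm]

theorem generatedBy [CompactSpace X] [T2Space X]
    (H : IsTransferExtension δ ι d t) (hS : S.GeneratedBy δ e) :
    S.naturalExtension.GeneratedBy d (H.spectrumHomeomorph hS).symm := by
  intro x b
  set h := (H.spectrumHomeomorph hS).symm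
  have hχ := H.spectrumHomeomorph_symm_apply hS
  have hd1 : h x (d 1) = eval e (x.1 0) (δ 1) := by
    rw [← hχ x 0, Function.iterate_zero_apply, ← H.apply_embed, map_one ι]
  refine ⟨fun hx => ?_, fun hx => ?_⟩
  · obtain ⟨y, hy, hxy⟩ := id hx
    have h1 : h x (d 1) = 1 := by
      rw [hd1, hxy, eval_inl, (hS y 1).1 hy, map_one]
    -- Since `h x (d 1) = 1`, the functional `h x ∘ d` is a character `χ`. It remains to compare it
    -- with the character of the shifted sequence on the elements `tⁿ(a)`.
    obtain ⟨p, hp⟩ := exists_eval_eq (Homeomorph.refl _)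
      (d : B →ₙₐ[ℂ] B) (h x)
    obtain ⟨χ, rfl⟩ := (eval_one_ne_zero_iff (Homeomorph.refl _)).1
      (show eval (Homeomorph.refl (characterSpace ℂ B)) p 1 ≠ 0 by
        rw [hp]; exact h1 ▸ one_ne_zero)
    replace hp : ∀ b, χ b = h x (d b) := hp
    rw [← hp]
    refine congrArg (fun ω : characterSpace ℂ B => ω b) (H.ext _ _ fun n a => ?_)
    rw [hp, hχ]
    cases n with
    | zero =>
      change _ = eval e (S.pointMap (x.1 0)) a
      rw [hxy, S.pointMap_inl y hy, eval_inl, ← (hS y a).1 hy, Function.iterate_zero_apply,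
        H.apply_embed]
      exact (hχ x 0 (δ a)).trans (by rw [hxy, eval_inl])
    | succ n =>
      rw [Function.iterate_succ_apply', H.apply_transfer, map_mul, h1, one_mul]
      exact hχ x n a
  · have h1 : h x (d 1) = 0 := by
      rw [hd1]
      rcases hx0 : x.1 0 with y | ⟨⟩
      · exact (hS y 1).2 fun hy => hx ⟨y, hy, hx0⟩
      · rfl
    rw [← one_mul b, map_mul, map_mul, h1, zero_mul]

end IsTransferExtension
end Generated

/-! ### The natural extension as an instance -/

namespace NaturalExtension
variable {A : Type u} [CommCStarAlgebra A] (δ : A →⋆ₙₐ[ℂ] A)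

/-- The complete transfer operator of the natural extension. -/
def transfer : NaturalExtension δ →ₙₐ[ℂ] NaturalExtension δ :=
  Tower.right (KernelUnitization.endo δ) (KernelUnitization.isStarProjection_unit δ)

theorem one_sub_transfer_one : 1 - transfer δ 1 =
    Tower.incl (KernelUnitization.endo δ) (KernelUnitization.isStarProjection_unit δ)
      (KernelUnitization.unit δ) := by
  rw [transfer, Tower.right_one _ _ (KernelUnitization.endo_unit δ), sub_sub_cancel]

/-- `A⁺` is generated by `A` and `q`: the first summand is cut out by `1 - q = transfer 1`, the
second by `q`. -/
theorem incl_eq (a b : A) :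
    Tower.incl (KernelUnitization.endo δ) (KernelUnitization.isStarProjection_unit δ)
      ((kernelIdeal δ).proj a, (kernelIdeal δ).orthogonal.proj b) =
    transfer δ 1 * embed δ a + (1 - transfer δ 1) * embed δ b := by
  rw [← sub_sub_cancel 1 (transfer δ 1), one_sub_transfer_one, sub_sub_cancel]
  have h : ∀ c, embed δ c = Tower.incl (KernelUnitization.endo δ)
    (KernelUnitization.isStarProjection_unit δ) (KernelUnitization.embed δ c) := fun _ => rfl
  rw [h, h, ← map_one (Tower.incl (KernelUnitization.endo δ)
    (KernelUnitization.isStarProjection_unit δ)), ← map_sub, ← map_mul, ← map_mul, ← map_add]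
  congr 1
  refine Prod.ext ?_ ?_
  · change _ = (1 - 0) * (kernelIdeal δ).proj a + 0 * (kernelIdeal δ).proj b
    ring
  · change _ = (1 - 1) * (kernelIdeal δ).orthogonal.proj a + 1 * (kernelIdeal δ).orthogonal.proj b
    ring

theorem isTransferExtension : IsTransferExtension δ (embed δ) (endo δ) (transfer δ) where
  injective := (Tower.incl_injective _ _ (KernelUnitization.unit_mul_of_endo_eq_zero δ)).comp
    (KernelUnitization.embed_injective δ)
  apply_embed := endo_embed δ
  apply_transfer := Tower.left_right _ _
  transfer_apply := Tower.right_left _ _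
  mem_orthogonal_iff := fun a => by
    rw [one_sub_transfer_one]
    change Tower.incl _ _ _ * Tower.incl _ _ (KernelUnitization.embed δ a) = 0 ↔ _
    rw [← map_mul, map_eq_zero_iff _
      (Tower.incl_injective _ _ (KernelUnitization.unit_mul_of_endo_eq_zero δ))]
    have h : KernelUnitization.unit δ * KernelUnitization.embed δ a =
        (0, (kernelIdeal δ).orthogonal.proj a) :=
      Prod.ext (zero_mul _) (one_mul _)
    rw [h, Prod.mk_eq_zero, ← map_zero (kernelIdeal δ).orthogonal.proj, CStarIdeal.proj_eq_iff,
      sub_zero]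
    exact and_iff_right rfl
  ext := fun χ χ' h => by
    -- Agreement after every power of `transfer` is a property stable under `transfer` itself, as
    -- the induction over generators requires.
    have key : ∀ b : NaturalExtension δ, ∀ n, χ ((transfer δ)^[n] b) = χ' ((transfer δ)^[n] b) := by
      have hcont : ∀ n, Continuous (transfer δ)^[n] := fun n => (Tower.continuous_right _ _).iterate n
      have hadd : ∀ a b : NaturalExtension δ,
          (∀ n, χ ((transfer δ)^[n] a) = χ' ((transfer δ)^[n] a)) →
          (∀ n, χ ((transfer δ)^[n] b) = χ' ((transfer δ)^[n] b)) →
          ∀ n, χ ((transfer δ)^[n] (a + b)) = χ' ((transfer δ)^[n] (a + b)) :=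
        fun a b ha hb n => by rw [iterate_map_add, map_add, map_add, ha, hb]
      have hmul : ∀ a b : NaturalExtension δ,
          (∀ n, χ ((transfer δ)^[n] a) = χ' ((transfer δ)^[n] a)) →
          (∀ n, χ ((transfer δ)^[n] b) = χ' ((transfer δ)^[n] b)) →
          ∀ n, χ ((transfer δ)^[n] (a * b)) = χ' ((transfer δ)^[n] (a * b)) :=
        fun a b ha hb n => by rw [iterate_map_mul, map_mul, map_mul, ha, hb]
      have hright : ∀ b : NaturalExtension δ,
          (∀ n, χ ((transfer δ)^[n] b) = χ' ((transfer δ)^[n] b)) →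
          ∀ n, χ ((transfer δ)^[n] (transfer δ b)) = χ' ((transfer δ)^[n] (transfer δ b)) :=
        fun b hb n => hb (n + 1)
      have hembed : ∀ a n, χ ((transfer δ)^[n] (embed δ a)) = χ' ((transfer δ)^[n] (embed δ a)) :=
        fun a n => h n a
      have hone : ∀ n, χ ((transfer δ)^[n] (transfer δ 1)) = χ' ((transfer δ)^[n] (transfer δ 1)) :=
        hright _ fun n => by rw [← map_one (embed δ)]; exact hembed 1 n
      refine Tower.induction_on _ _ (KernelUnitization.endo_unit δ) ?_ ?_ hadd hmul hright
      · rw [Set.ofPred_forall]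
        exact isClosed_iInter fun n => isClosed_eq
          ((map_continuous χ).comp (hcont n)) ((map_continuous χ').comp (hcont n))
      · rintro ⟨x, y⟩
        obtain ⟨a, rfl⟩ := (kernelIdeal δ).proj_surjective x
        obtain ⟨b, rfl⟩ := (kernelIdeal δ).orthogonal.proj_surjective y
        -- Written so that only sums and products of `transfer 1` and elements of `A` occur.
        have e1 : transfer δ 1 * embed δ a + (1 - transfer δ 1) * embed δ b =
            transfer δ 1 * embed δ (a - b) + embed δ b := by rw [map_sub]; ring
        rw [incl_eq, e1]
        exact hadd _ _ (hmul _ _ hone (hembed _)) (hembed _)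
    exact DFunLike.ext _ _ fun b => key b 0

end NaturalExtension
end NatExt

end

theorem mainTheorem6 {X : Type v} [TopologicalSpace X] [CompactSpace X] [T2Space X]
    {A : Type u} [CommCStarAlgebra A] (δ : A →⋆ₙₐ[ℂ] A) (S : NatExt.PartialSystem X)
    (e : X ≃ₜ WeakDual.characterSpace ℂ A) (hS : S.GeneratedBy δ e) :
    Topology.IsOpenEmbedding S.naturalExtension.map ∧ S.naturalExtension.image = S.extImage ∧
    ∃ δs : NatExt.NaturalExtension δ → NatExt.NaturalExtension δ,
      NatExt.IsCompleteTransferOperator (NatExt.NaturalExtension.endo δ) δs ∧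
      ∃ h : S.extSpace ≃ₜ WeakDual.characterSpace ℂ (NatExt.NaturalExtension δ),
        S.naturalExtension.GeneratedBy (NatExt.NaturalExtension.endo δ) h ∧
        ∀ (x : S.extSpace) (n : ℕ) (a : A),
          h x (δs^[n] (NatExt.NaturalExtension.embed δ a)) =
            Sum.elim (fun y : X => e y a) (fun _ => 0) (x.1 n) :=
  have H := NatExt.NaturalExtension.isTransferExtension δ
  ⟨S.isOpenEmbedding_naturalExtension, S.image_naturalExtension,
    NatExt.NaturalExtension.transfer δ, H.isCompleteTransferOperator,
    (H.spectrumHomeomorph hS).symm, H.generatedBy hS, H.spectrumHomeomorph_symm_apply hS⟩
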